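/- Let $\mathbb D$ be the open unit disc, $\mathbb T$ the unit circle and $m$ normalized Lebesgue measure on $\mathbb T$. For $0<p<\infty$ let $H^p$ be the space of analytic functions $h$ on $\mathbb D$ with $\|h\|_{H^p}^p=\sup_{0<r<1}\int_{\mathbb T}|h(r\zeta)|^p\,dm(\zeta)<\infty$, and let $H^\infty$ be the space of analytic functions $h$ on $\mathbb D$ with $\|h\|_{H^\infty}=\sup_{z\in\mathbb D}|h(z)|<\infty$. For $h$ in a Hardy space and $\zeta\in\mathbb T$ write $h(\zeta)=\lim_{r\to1^-}h(r\zeta)$ for its boundary value, defined for almost every $\zeta$. For $f\in H^\infty$ put $$\Lambda(f)=\operatorname*{ess\,sup}_{\eta\in\mathbb T}\int_{\mathbb T}\frac{|f(\zeta)-f(\eta)|}{|\zeta-\eta|}\,dm(\zeta)\in[0,\infty],$$ and for $p\in\{1,\infty\}$ and $h\in H^p$ put $$(T_fh)(z)=\int_{\mathbb T}\frac{\overline{f(\zeta)}\,h(\zeta)}{1-\overline{\zeta}z}\,dm(\zeta),\qquad z\in\mathbb D.$$ **Theorem 1.** Let $f\in H^\infty$ with $\Lambda(f)<\infty$, and let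 $p=1$ or $p=\infty$. Then the integral defining $(T_fh)(z)$ converges absolutely for all $h\in H^p$ and $z\in\mathbb D$, and $T_f$ is a bounded linear operator from $H^p$ to $H^p$ with $$\|T_fh\|_{H^p}\le\bigl(\|f\|_{H^\infty}+\Lambda(f)\bigr)\|h\|_{H^p}\quad\text{for all }h\in H^p,$$ that is, $\|T_f\|_{H^p}\le\|f\|_{H^\infty}+\Lambda(f)$. -/

import Mathlib

open MeasureTheory Set Filter Topology
open scoped ENNReal ComplexConjugate

namespace HardyToeplitz

/-- Normalized Lebesgue measure `m` on the unit circle, as a measure on `ℂ`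
carried by the circle: the image of `dθ / 2π` on `(0, 2π]` under `θ ↦ exp (i θ)`. -/
noncomputable def circleMeasure : Measure ℂ :=
  Measure.map (circleMap 0 1)
    (ENNReal.ofReal (2 * Real.pi)⁻¹ • volume.restrict (Ioc 0 (2 * Real.pi)))

instance : IsProbabilityMeasure circleMeasure := by
  constructor
  rw [circleMeasure, Measure.map_apply (continuous_circleMap 0 1).measurable MeasurableSet.univ]
  have h : (0 : ℝ) < 2 * Real.pi := Real.two_pi_pos
  simp only [preimage_univ, Measure.smul_apply, Measure.restrict_apply_univ, Real.volume_Ioc,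
    sub_zero, smul_eq_mul]
  rw [← ENNReal.ofReal_mul (by positivity), inv_mul_cancel₀ h.ne', ENNReal.ofReal_one]

/-- The Hardy (quasi-)norm, with values in `[0, ∞]`, of a function on the unit disc
(values of `f` outside the disc are irrelevant), for `0 < p ≤ ∞`. -/
noncomputable def hardyNorm (p : ℝ≥0∞) (f : ℂ → ℂ) : ℝ≥0∞ :=
  if p = ∞ then ⨆ z ∈ Metric.ball (0 : ℂ) 1, ‖f z‖ₑ
  else (⨆ r ∈ Ioo (0 : ℝ) 1,
    ∫⁻ ζ, ‖f ((r : ℂ) * ζ)‖ₑ ^ p.toReal ∂circleMeasure) ^ (1 / p.toReal)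

/-- Membership in the Hardy space `H^p`: analytic in the unit disc, with finite norm. -/
def MemHardy (p : ℝ≥0∞) (f : ℂ → ℂ) : Prop :=
  DifferentiableOn ℂ f (Metric.ball 0 1) ∧ hardyNorm p f < ∞

/-- The boundary function `ζ ↦ lim_{r → 1⁻} f (r ζ)` (for `f` in a Hardy space the limit
exists at almost every `ζ` on the circle; elsewhere the value is arbitrary). -/
noncomputable def boundaryValue (f : ℂ → ℂ) (ζ : ℂ) : ℂ :=
  limUnder (𝓝[<] (1 : ℝ)) (fun r : ℝ => f ((r : ℂ) * ζ))

/-- `Λ(f) = ess sup_η ∫ |f(ζ) - f(η)| / |ζ - η| dm(ζ)`, with values in `[0, ∞]`. -/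
noncomputable def lambda (f : ℂ → ℂ) : ℝ≥0∞ :=
  essSup (fun η : ℂ =>
    ∫⁻ ζ, ‖boundaryValue f ζ - boundaryValue f η‖ₑ / ‖ζ - η‖ₑ ∂circleMeasure) circleMeasure

/-- The integrand of the Toeplitz operator at the point `z`. -/
noncomputable def toeplitzIntegrand (f h : ℂ → ℂ) (z ζ : ℂ) : ℂ :=
  conj (boundaryValue f ζ) * boundaryValue h ζ / (1 - conj ζ * z)

/-- The function `T_f h`, `(T_f h)(z) = ∫ conj (f(ζ)) h(ζ) / (1 - conj ζ z) dm(ζ)`. -/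
noncomputable def toeplitz (f h : ℂ → ℂ) (z : ℂ) : ℂ :=
  ∫ ζ, toeplitzIntegrand f h z ζ ∂circleMeasure

end HardyToeplitz

namespace HardyToeplitz

/-! Since `h` in `H¹` is the Cauchy integral of its boundary values, subtracting a constant `c` from
`f` changes `T_f h` only by `conj c * h`. At `z = rη` take `c = f(η)`. As `|1 - conj ζ z| = |ζ - rη|
≥ √r |ζ - η|`, this gives `|T_f h(rη)| ≤ |f(η)| |h(rη)| + r^(-1/2) ∫ |f(ζ) - f(η)| / |ζ - η| ·
|h(ζ)| dm(ζ)`, which is `enorm_toeplitz_le`. For `p = ∞` the integral is at most `Λ(f) ‖h‖_∞`. For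
`p = 1` integrate in `η` and use Tonelli: the difference quotient is symmetric, so `Λ(f)` bounds it
in the other variable as well. The factor `r^(-1/2)` disappears as `r → 1`, by the maximum principle
(`p = ∞`) or because integral means increase with the radius (`p = 1`).

Most of the work is the boundary theory of `H¹` behind `MemHardy.boundaryValue_spec`. Fatou's
theorem reduces it to writing `h` as the Poisson and Cauchy integral of an integrable function
(`exists_integrable_forall_integral_eq`). For this, approximate `h` by polynomials bounded in `L¹`
of the circle and split each as `a b` with `|a|² = |b|²` equal to its modulus on the circle. The
factors are bounded in `H²`, so their Fourier coefficients converge along an ultrafilter, and the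
product of the two `L²` limits is the required function. -/

lemma ae_norm_eq_one : ∀ᵐ ζ ∂circleMeasure, ‖ζ‖ = 1 := by
  rw [circleMeasure, ae_map_iff (continuous_circleMap 0 1).aemeasurable
    (measurableSet_eq_fun measurable_norm measurable_const)]
  exact Eventually.of_forall fun θ => by simp

lemma circleMeasure_restrict_sphere :
    circleMeasure.restrict (Metric.sphere 0 1) = circleMeasure :=
  Measure.restrict_eq_self_of_ae_mem (by
    filter_upwards [ae_norm_eq_one] with ζ hζ using by simpa using hζ)

lemma integrable_of_continuousOn_sphere {E : Type*} [NormedAddCommGroup E] {g : ℂ → E}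
    (hg : ContinuousOn g (Metric.sphere 0 1)) : Integrable g circleMeasure := by
  rw [← circleMeasure_restrict_sphere]
  exact hg.integrableOn_compact (isCompact_sphere 0 1)

lemma integral_circleMeasure {E : Type*} [NormedAddCommGroup E] [NormedSpace ℝ E] {g : ℂ → E}
    (hg : AEStronglyMeasurable g circleMeasure) :
    ∫ ζ, g ζ ∂circleMeasure = Real.circleAverage g 0 1 := by
  rw [circleMeasure] at hg ⊢
  rw [integral_map (continuous_circleMap 0 1).aemeasurable hg, integral_smul_measure,
    Real.circleAverage_def, intervalIntegral.integral_of_le Real.two_pi_pos.le,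
    ENNReal.toReal_ofReal (by positivity)]

lemma integral_circleMeasure_of_continuousOn {E : Type*} [NormedAddCommGroup E] [NormedSpace ℝ E]
    {g : ℂ → E} (hg : ContinuousOn g (Metric.sphere 0 1)) :
    ∫ ζ, g ζ ∂circleMeasure = Real.circleAverage g 0 1 :=
  integral_circleMeasure (integrable_of_continuousOn_sphere hg).aestronglyMeasurable

/-! ### Poisson and Cauchy kernels, and their reproducing formulas on the disc algebra. -/

lemma one_sub_norm_le {z ζ : ℂ} (hζ : ‖ζ‖ = 1) : 1 - ‖z‖ ≤ ‖ζ - z‖ := by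
  simpa [hζ] using norm_sub_norm_le ζ z

lemma norm_one_sub_conj_mul {z ζ : ℂ} (hζ : ‖ζ‖ = 1) : ‖1 - conj ζ * z‖ = ‖ζ - z‖ := by
  have h : ζ * (1 - conj ζ * z) = ζ - z := by
    have : ζ * conj ζ = 1 := by rw [Complex.mul_conj, Complex.normSq_eq_norm_sq, hζ]; simp
    linear_combination -z * this
  rw [← h, norm_mul, hζ, one_mul]

lemma sub_ne_zero_of_norm {z ζ : ℂ} (hζ : ‖ζ‖ = 1) (hz : ‖z‖ < 1) : ζ - z ≠ 0 := by
  rw [← norm_pos_iff]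
  linarith [one_sub_norm_le (z := z) hζ]

lemma one_sub_conj_mul_ne_zero {z ζ : ℂ} (hζ : ‖ζ‖ = 1) (hz : ‖z‖ < 1) : 1 - conj ζ * z ≠ 0 := by
  rw [← norm_ne_zero_iff, norm_one_sub_conj_mul hζ, norm_ne_zero_iff]
  exact sub_ne_zero_of_norm hζ hz

lemma poissonKernel_of_norm_eq_one {z ζ : ℂ} (hζ : ‖ζ‖ = 1) :
    poissonKernel 0 z ζ = (1 - ‖z‖ ^ 2) / ‖ζ - z‖ ^ 2 := by
  simp [poissonKernel_def, hζ]

lemma poissonKernel_nonneg {z ζ : ℂ} (hζ : ‖ζ‖ = 1) (hz : ‖z‖ < 1) : 0 ≤ poissonKernel 0 z ζ := by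
  rw [poissonKernel_of_norm_eq_one hζ]
  have : ‖z‖ ^ 2 ≤ 1 := pow_le_one₀ (norm_nonneg _) hz.le
  positivity [sub_nonneg.2 this]

lemma continuousOn_poissonKernel {z : ℂ} (hz : ‖z‖ < 1) :
    ContinuousOn (poissonKernel 0 z) (Metric.sphere 0 1) := by
  unfold poissonKernel
  refine ContinuousOn.div (by fun_prop) (by fun_prop) fun ζ hζ => ?_
  simpa using sub_ne_zero_of_norm (by simpa using hζ) hz

lemma continuousOn_cauchyKernel {z : ℂ} (hz : ‖z‖ < 1) :
    ContinuousOn (fun ζ : ℂ => (1 - conj ζ * z)⁻¹) (Metric.sphere 0 1) :=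
  ContinuousOn.inv₀ (by fun_prop) fun _ hζ =>
    one_sub_conj_mul_ne_zero (by simpa using hζ) hz

lemma _root_.DiffContOnCl.continuousOn_sphere {F : ℂ → ℂ}
    (hF : DiffContOnCl ℂ F (Metric.ball 0 1)) : ContinuousOn F (Metric.sphere 0 1) :=
  hF.continuousOn_ball.mono Metric.sphere_subset_closedBall

lemma integral_poissonKernel_mul {F : ℂ → ℂ} (hF : DiffContOnCl ℂ F (Metric.ball 0 1)) {z : ℂ}
    (hz : ‖z‖ < 1) : ∫ ζ, (poissonKernel 0 z ζ : ℂ) * F ζ ∂circleMeasure = F z := by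
  have hc : ContinuousOn (fun ζ => (poissonKernel 0 z ζ : ℂ) * F ζ) (Metric.sphere 0 1) :=
    (Complex.continuous_ofReal.comp_continuousOn (continuousOn_poissonKernel hz)).mul
      hF.continuousOn_sphere
  rw [integral_circleMeasure_of_continuousOn hc,
    ← hF.circleAverage_poissonKernel_smul (w := z) (by simpa using hz)]
  rfl

/-- On the circle `1 / (1 - conj ζ z) = ζ / (ζ - z)`, so this is Cauchy's formula. -/
lemma integral_div_one_sub_conj_mul {F : ℂ → ℂ} (hF : DiffContOnCl ℂ F (Metric.ball 0 1)) {z : ℂ}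
    (hz : ‖z‖ < 1) : ∫ ζ, F ζ / (1 - conj ζ * z) ∂circleMeasure = F z := by
  have hc : ContinuousOn (fun ζ => F ζ / (1 - conj ζ * z)) (Metric.sphere 0 1) := by
    simp_rw [div_eq_mul_inv]
    exact hF.continuousOn_sphere.mul (continuousOn_cauchyKernel hz)
  rw [integral_circleMeasure_of_continuousOn hc,
    ← DiffContOnCl.circleAverage_smul_div (f := F) (R := 1) (w := z) (c := 0) (by simpa using hF)
      (by simpa using hz)]
  refine Real.circleAverage_congr_sphere fun ζ hζ => ?_
  have h1 : ‖ζ‖ = 1 := by simpa using hζ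
  have h2 := one_sub_conj_mul_ne_zero h1 hz
  have h3 := sub_ne_zero_of_norm h1 hz
  have : ζ * conj ζ = 1 := by rw [Complex.mul_conj, Complex.normSq_eq_norm_sq, h1]; simp
  simp only [sub_zero, smul_eq_mul]
  rw [div_mul_eq_mul_div, div_eq_div_iff h2 h3]
  linear_combination z * F ζ * this

lemma integral_poissonKernel {z : ℂ} (hz : ‖z‖ < 1) :
    ∫ ζ, poissonKernel 0 z ζ ∂circleMeasure = 1 := by
  have := integral_poissonKernel_mul (F := fun _ => 1) diffContOnCl_const hz
  simp only [mul_one] at this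
  rw [integral_complex_ofReal] at this
  exact_mod_cast this

lemma lintegral_poissonKernel {z : ℂ} (hz : ‖z‖ < 1) :
    ∫⁻ ζ, ENNReal.ofReal (poissonKernel 0 z ζ) ∂circleMeasure = 1 := by
  rw [← ofReal_integral_eq_lintegral_ofReal
    (integrable_of_continuousOn_sphere (continuousOn_poissonKernel hz)), integral_poissonKernel hz,
    ENNReal.ofReal_one]
  filter_upwards [ae_norm_eq_one] with ζ hζ using poissonKernel_nonneg hζ hz

/-! ### Chord length and the measure of arcs. -/

lemma norm_circleMap_sub_ge {s t : ℝ} (h : |s - t| ≤ Real.pi) :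
    2 / Real.pi * |s - t| ≤ ‖circleMap 0 1 s - circleMap 0 1 t‖ := by
  have e : circleMap 0 1 s - circleMap 0 1 t
      = circleMap 0 1 t * (Complex.exp (Complex.I * (s - t : ℝ)) - 1) := by
    simp only [circleMap_zero, Complex.ofReal_one, one_mul, mul_sub, ← Complex.exp_add, mul_one]
    congr 2
    push_cast; ring
  rw [e, norm_mul, norm_circleMap_zero, Complex.norm_exp_I_mul_ofReal_sub_one, abs_one, one_mul,
    norm_mul, Real.norm_eq_abs, Real.norm_eq_abs, abs_two]
  have := Real.mul_abs_le_abs_sin (x := (s - t) / 2) (by rw [abs_div, abs_two]; linarith)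
  rw [abs_div, abs_two] at this
  linarith

lemma circleMeasure_closedBall_le {η : ℂ} (hη : ‖η‖ = 1) {δ : ℝ} (hδ : 0 ≤ δ) :
    circleMeasure (Metric.closedBall η δ) ≤ ENNReal.ofReal (2 * δ) := by
  have hpi := Real.pi_pos
  obtain ⟨t, ht, rfl⟩ : ∃ t ∈ Ioc (0 : ℝ) (2 * Real.pi), circleMap 0 1 t = η := by
    have : η ∈ circleMap 0 1 '' Ioc 0 (2 * Real.pi) := by
      rw [image_circleMap_Ioc]; simpa using hη
    exact this
  rw [circleMeasure, Measure.map_apply (continuous_circleMap 0 1).measurable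
    Metric.isClosed_closedBall.measurableSet, Measure.smul_apply,
    Measure.restrict_apply ((continuous_circleMap 0 1).measurable
      Metric.isClosed_closedBall.measurableSet)]
  -- The arc may wrap around the end of the parameter interval, hence the three translates of `t` by
  -- multiples of `2π`. Their total length `3πδ`, divided by `2π`, is below `2δ`.
  let J : ℝ → Set ℝ := fun c => Icc (c - Real.pi / 2 * δ) (c + Real.pi / 2 * δ)
  have hJ : ∀ c, volume (J c) = ENNReal.ofReal (Real.pi * δ) := fun c => by
    rw [Real.volume_Icc]; congr 1; ring
  have hmem : ∀ s c : ℝ, |s - c| ≤ Real.pi → circleMap 0 1 c = circleMap 0 1 t →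
      circleMap 0 1 s ∈ Metric.closedBall (circleMap 0 1 t) δ → s ∈ J c := by
    intro s c hs hc h
    rw [← hc, mem_closedBall_iff_norm] at h
    have h2 := (norm_circleMap_sub_ge hs).trans h
    rw [div_mul_eq_mul_div, div_le_iff₀ hpi] at h2
    have h3 := abs_le.1 (show |s - c| ≤ Real.pi / 2 * δ by linarith)
    exact ⟨by linarith [h3.1], by linarith [h3.2]⟩
  have hsub : circleMap 0 1 ⁻¹' Metric.closedBall (circleMap 0 1 t) δ ∩ Ioc 0 (2 * Real.pi) ⊆
      J (t - 2 * Real.pi) ∪ J t ∪ J (t + 2 * Real.pi) := by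
    rintro s ⟨hs, hs1⟩
    have hp := periodic_circleMap 0 1
    rcases lt_or_ge (s - t) (-Real.pi) with h | h
    · refine Or.inl (Or.inl (hmem s _ ?_ (hp.sub_eq t) hs))
      rw [abs_le]; constructor <;> linarith [hs1.1, hs1.2, ht.1, ht.2]
    rcases le_or_gt (s - t) Real.pi with h' | h'
    · exact Or.inl (Or.inr (hmem s t (abs_le.2 ⟨h, h'⟩) rfl hs))
    · refine Or.inr (hmem s _ ?_ (hp t) hs)
      rw [abs_le]; constructor <;> linarith [hs1.1, hs1.2, ht.1, ht.2]
  have hvol := (measure_mono (μ := volume) hsub).trans ((measure_union_le _ _).trans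
    (add_le_add (measure_union_le _ _) le_rfl))
  rw [hJ, hJ, hJ] at hvol
  refine (mul_le_mul' le_rfl hvol).trans ?_
  rw [← ENNReal.ofReal_add (by positivity) (by positivity),
    ← ENNReal.ofReal_add (by positivity) (by positivity),
    ← ENNReal.ofReal_mul (by positivity)]
  refine ENNReal.ofReal_le_ofReal ?_
  rw [inv_mul_le_iff₀ (by positivity)]
  nlinarith [mul_nonneg hpi.le hδ]

/-! ### Square root factorization of polynomials. -/

/-- `q` is on the closed unit disc a product of two disc algebra functions, both of which have
modulus `|q|^(1/2)` on the circle. -/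
def HasSqrtFactorization (q : ℂ → ℂ) : Prop :=
  ∃ a b : ℂ → ℂ, DiffContOnCl ℂ a (Metric.ball 0 1) ∧ DiffContOnCl ℂ b (Metric.ball 0 1) ∧
    (∀ w, ‖w‖ ≤ 1 → q w = a w * b w) ∧
    ∀ w, ‖w‖ = 1 → ‖a w‖ ^ 2 = ‖q w‖ ∧ ‖b w‖ ^ 2 = ‖q w‖

lemma HasSqrtFactorization.mul {p q : ℂ → ℂ} (hp : HasSqrtFactorization p)
    (hq : HasSqrtFactorization q) : HasSqrtFactorization (fun w => p w * q w) := by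
  obtain ⟨a, b, ha, hb, hab, hn⟩ := hp
  obtain ⟨c, d, hc, hd, hcd, hn'⟩ := hq
  refine ⟨fun w => a w * c w, fun w => b w * d w, ha.smul hc, hb.smul hd, fun w hw => ?_,
    fun w hw => ?_⟩
  · simp only [hab w hw, hcd w hw]; ring
  · simp only [norm_mul, mul_pow, (hn w hw).1, (hn w hw).2, (hn' w hw).1, (hn' w hw).2, and_self]

lemma hasSqrtFactorization_of_sq {q a : ℂ → ℂ} (ha : DiffContOnCl ℂ a (Metric.ball 0 1))
    (h : ∀ w, a w ^ 2 = q w) : HasSqrtFactorization q :=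
  ⟨a, a, ha, ha, fun w _ => by rw [← h, sq], fun w _ => by rw [← h, norm_pow, and_self]⟩

lemma hasSqrtFactorization_const (c : ℂ) : HasSqrtFactorization fun _ => c := by
  obtain ⟨s, hs⟩ := IsAlgClosed.exists_pow_nat_eq c two_pos
  exact hasSqrtFactorization_of_sq (a := fun _ => s) diffContOnCl_const fun _ => hs

/-- `1 - u w` has positive real part in the open disc, so the principal root is analytic there. On
the boundary it can reach `0`, where the root is still continuous. -/
lemma diffContOnCl_sqrt_one_sub {u : ℂ} (hu : ‖u‖ ≤ 1) :
    DiffContOnCl ℂ (fun w : ℂ => (1 - u * w) ^ (1 / 2 : ℂ)) (Metric.ball 0 1) := by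
  have hre : ∀ w : ℂ, (u * w).re ≤ ‖w‖ := fun w =>
    (Complex.re_le_norm _).trans (by rw [norm_mul]; nlinarith [norm_nonneg w])
  refine ⟨fun w hw => ?_, ?_⟩
  · refine DifferentiableAt.differentiableWithinAt ?_
    refine DifferentiableAt.cpow_const (by fun_prop) (Or.inl ?_)
    have hw : ‖w‖ < 1 := by simpa using hw
    have := hre w
    simp only [Complex.sub_re, Complex.one_re]
    linarith
  · rw [closure_ball _ one_ne_zero]
    intro w hw
    have hw : ‖w‖ ≤ 1 := by simpa using hw
    have := hre w
    refine ContinuousAt.continuousWithinAt ?_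
    refine ContinuousAt.comp (f := fun w : ℂ => 1 - u * w) (g := fun x : ℂ => x ^ (1 / 2 : ℂ))
      (Complex.continuousAt_cpow_const_of_re_pos (Or.inl ?_) (by norm_num)) (by fun_prop)
    simp only [Complex.sub_re, Complex.one_re]
    linarith

lemma sqrt_sq (x : ℂ) : (x ^ (1 / 2 : ℂ)) ^ 2 = x := by
  rw [← Complex.cpow_nat_inv_pow x two_ne_zero]
  simp

/-- A zero outside the open disc leaves an analytic square root of `1 - w / z`. For a zero inside,
`1 - conj z w` has no zero on the closed disc and the same modulus as `w - z` on the circle; with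
`k` its root, the factors are `(w - z) / k` and `k`. -/
lemma hasSqrtFactorization_sub (z : ℂ) : HasSqrtFactorization fun w => w - z := by
  rcases le_or_gt 1 ‖z‖ with hz | hz
  · have hz0 : z ≠ 0 := norm_pos_iff.1 (by linarith)
    have h1 : HasSqrtFactorization fun w => 1 - z⁻¹ * w :=
      hasSqrtFactorization_of_sq (diffContOnCl_sqrt_one_sub (by
        rw [norm_inv]; exact inv_le_one_of_one_le₀ hz)) fun w => sqrt_sq _
    convert! (hasSqrtFactorization_const (-z)).mul h1 using 2 with w
    field_simp
    ring
  · have hk := diffContOnCl_sqrt_one_sub (u := conj z) (by simpa using hz.le)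
    set k : ℂ → ℂ := fun w => (1 - conj z * w) ^ (1 / 2 : ℂ) with hkdef
    have hk2 : ∀ w, k w ^ 2 = 1 - conj z * w := fun w => sqrt_sq _
    have hk0 : ∀ w, ‖w‖ ≤ 1 → k w ≠ 0 := by
      intro w hw h0
      have h1 := hk2 w
      rw [h0, zero_pow two_ne_zero, eq_comm, sub_eq_zero] at h1
      have h2 : ‖conj z * w‖ < 1 := by
        rw [norm_mul, Complex.norm_conj]
        nlinarith [norm_nonneg w, norm_nonneg z]
      rw [← h1] at h2
      simp at h2
    have hinv := hk.inv (fun w hw => hk0 w (by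
      rw [closure_ball _ one_ne_zero] at hw; simpa using hw))
    have hid : DiffContOnCl ℂ (fun w : ℂ => w - z) (Metric.ball 0 1) :=
      (differentiable_id.sub_const z).diffContOnCl
    refine ⟨fun w => (w - z) * (k w)⁻¹, k, hid.smul hinv, hk, fun w hw => ?_, fun w hw => ?_⟩
    · rw [inv_mul_cancel_right₀ (hk0 w hw)]
    · have h1 : ‖k w‖ ^ 2 = ‖w - z‖ := by
        rw [← norm_pow, hk2, ← norm_one_sub_conj_mul hw, ← Complex.norm_conj]
        simp [mul_comm]
      refine ⟨?_, h1⟩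
      rw [norm_mul, mul_pow, norm_inv, inv_pow, h1, sq,
        mul_inv_cancel_right₀ (h1 ▸ pow_ne_zero 2 (norm_ne_zero_iff.2 (hk0 w hw.le)))]

lemma hasSqrtFactorization_eval (q : Polynomial ℂ) : HasSqrtFactorization fun w => q.eval w := by
  have hs := IsAlgClosed.splits q
  have key : ∀ s : Multiset ℂ, HasSqrtFactorization fun w => (s.map fun z => w - z).prod := by
    intro s
    induction s using Multiset.induction_on with
    | empty => simpa using hasSqrtFactorization_const 1
    | cons z s ih => simpa using (hasSqrtFactorization_sub z).mul ih
  convert! (hasSqrtFactorization_const q.leadingCoeff).mul (key q.roots) using 2 with w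
  exact hs.eval_eq_prod_roots w

/-! ### Fatou's theorem on radial limits of Poisson integrals. -/

lemma norm_real_mul_lt_one {r : ℝ} (h0 : 0 < r) (h1 : r < 1) {η : ℂ} (hη : ‖η‖ = 1) :
    ‖(r : ℂ) * η‖ < 1 := by
  rw [norm_mul, hη, mul_one, Complex.norm_real, Real.norm_of_nonneg h0.le]; exact h1

/-- Dyadic decomposition about `η` at scale `1 - r`: at distance about `2^j (1 - r)` the kernel is
of size `1 / (4^j (1 - r))`. A single term of the series, for the smallest ball containing `ζ`,
already suffices. -/
lemma poissonKernel_le_tsum {r : ℝ} (h0 : 0 < r) (h1 : r < 1) {η ζ : ℂ} (hη : ‖η‖ = 1)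
    (hζ : ‖ζ‖ = 1) :
    ENNReal.ofReal (poissonKernel 0 (r * η) ζ) ≤
      ∑' j : ℕ, (Metric.closedBall η (2 ^ j * (1 - r))).indicator
        (fun _ => ENNReal.ofReal (32 / (4 ^ j * (1 - r)))) ζ := by
  have hy : 0 < 1 - r := by linarith
  have hn : ‖(r : ℂ) * η‖ = r := by
    rw [norm_mul, hη, mul_one, Complex.norm_real, Real.norm_of_nonneg h0.le]
  have hD1 : 1 - r ≤ ‖ζ - r * η‖ := by
    have := one_sub_norm_le (z := (r : ℂ) * η) hζ
    rwa [hn] at this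
  have hD2 : ‖ζ - η‖ ≤ 2 * ‖ζ - r * η‖ := by
    have e : ζ - η = (ζ - r * η) - ((1 - r : ℝ) : ℂ) * η := by push_cast; ring
    have := norm_sub_le (ζ - r * η) (((1 - r : ℝ) : ℂ) * η)
    rw [← e, norm_mul, hη, mul_one, Complex.norm_real, Real.norm_of_nonneg hy.le] at this
    linarith
  have hex : ∃ j : ℕ, ‖ζ - η‖ ≤ 2 ^ j * (1 - r) := by
    obtain ⟨j, hj⟩ := pow_unbounded_of_one_lt (‖ζ - η‖ / (1 - r)) (one_lt_two (α := ℝ))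
    exact ⟨j, ((div_lt_iff₀ hy).1 hj).le⟩
  classical
  have hmin := fun i => Nat.find_min hex (m := i)
  have hspec := Nat.find_spec hex
  set j := Nat.find hex
  refine le_trans ?_ (ENNReal.le_tsum j)
  rw [indicator_of_mem (by rwa [mem_closedBall_iff_norm])]
  refine ENNReal.ofReal_le_ofReal ?_
  rw [poissonKernel_of_norm_eq_one hζ, hn,
    div_le_div_iff₀ (by have := hy.trans_le hD1; positivity) (by positivity)]
  have hr2 : 1 - r ^ 2 ≤ 2 * (1 - r) := by nlinarith
  -- For `j = 0` use `|ζ - rη| ≥ 1 - r`. Otherwise minimality of `j` gives `2^(j-1) (1 - r) < |ζ -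
  -- η| ≤ 2 |ζ - rη|`.
  have hmain : 4 ^ j * (1 - r) ^ 2 ≤ 16 * ‖ζ - r * η‖ ^ 2 := by
    rcases Nat.eq_zero_or_pos j with hj | hj
    · rw [hj]; nlinarith
    · have h2 := hmin (j - 1) (by omega)
      rw [not_le] at h2
      have h3 : 2 ^ j * (1 - r) ≤ 4 * ‖ζ - r * η‖ := by
        have : (2 : ℝ) ^ j = 2 * 2 ^ (j - 1) := by rw [← pow_succ', Nat.sub_add_cancel hj]
        rw [this]; linarith
      have h4 : (4 : ℝ) ^ j = (2 ^ j) ^ 2 := by rw [← pow_mul, mul_comm, pow_mul]; norm_num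
      rw [h4, ← mul_pow]
      have : 0 ≤ 2 ^ j * (1 - r) := by positivity
      nlinarith
  calc (1 - r ^ 2) * (4 ^ j * (1 - r)) ≤ 2 * (1 - r) * (4 ^ j * (1 - r)) := by gcongr
    _ = 2 * (4 ^ j * (1 - r) ^ 2) := by ring
    _ ≤ 32 * ‖ζ - r * η‖ ^ 2 := by linarith

/-- Almost every point is a Lebesgue point. The mass of a ball is at most `2δ`, so one may divide by
`δ` instead. -/
lemma tendsto_lintegral_closedBall_div {φ : ℂ → ℂ} (hφ : Integrable φ circleMeasure) :
    ∀ᵐ η ∂circleMeasure, Tendsto (fun δ : ℝ =>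
      (∫⁻ ζ in Metric.closedBall η δ, ‖φ ζ - φ η‖ₑ ∂circleMeasure) / ENNReal.ofReal δ)
      (𝓝[>] 0) (𝓝 0) := by
  filter_upwards [(Besicovitch.vitaliFamily
    circleMeasure).ae_tendsto_lintegral_enorm_sub_div_of_integrable hφ, ae_norm_eq_one] with η h hη
  have h' := h.comp (Besicovitch.tendsto_filterAt circleMeasure η)
  have h2 : Tendsto (fun δ : ℝ => 2 * ((∫⁻ ζ in Metric.closedBall η δ, ‖φ ζ - φ η‖ₑ ∂circleMeasure)
      / circleMeasure (Metric.closedBall η δ))) (𝓝[>] 0) (𝓝 0) := by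
    simpa using ENNReal.Tendsto.const_mul h' (a := 2) (Or.inr (by simp))
  refine tendsto_of_tendsto_of_tendsto_of_le_of_le' tendsto_const_nhds h2
    (Eventually.of_forall fun _ => zero_le) ?_
  filter_upwards [self_mem_nhdsWithin] with δ (hδ : 0 < δ)
  refine ENNReal.div_le_of_le_mul ?_
  set G := ∫⁻ ζ in Metric.closedBall η δ, ‖φ ζ - φ η‖ₑ ∂circleMeasure with hG
  set M := circleMeasure (Metric.closedBall η δ) with hM
  by_cases hM0 : M = 0
  · have : G = 0 := by rw [hG, Measure.restrict_eq_zero.2 hM0, lintegral_zero_measure]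
    simp [this]
  calc G = G / M * M := (ENNReal.div_mul_cancel hM0 (measure_ne_top _ _)).symm
    _ ≤ G / M * ENNReal.ofReal (2 * δ) := by gcongr; exact circleMeasure_closedBall_le hη hδ.le
    _ = 2 * (G / M) * ENNReal.ofReal δ := by
      rw [ENNReal.ofReal_mul (by norm_num), ENNReal.ofReal_ofNat]; ring

/-- The limit controls small `δ`, the total integral the others. The uniform bound serves as the
majorant over all dyadic scales. -/
lemma exists_lintegral_closedBall_div_le {g : ℂ → ℝ≥0∞} {η : ℂ}
    (hg : ∫⁻ ζ, g ζ ∂circleMeasure ≠ ∞)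
    (h : Tendsto (fun δ : ℝ => (∫⁻ ζ in Metric.closedBall η δ, g ζ ∂circleMeasure)
      / ENNReal.ofReal δ) (𝓝[>] 0) (𝓝 0)) :
    ∃ M : ℝ≥0∞, M ≠ ∞ ∧ ∀ δ : ℝ, 0 < δ →
      (∫⁻ ζ in Metric.closedBall η δ, g ζ ∂circleMeasure) / ENNReal.ofReal δ ≤ M := by
  have h1 := h.eventually (Iic_mem_nhds (zero_lt_one' ℝ≥0∞))
  obtain ⟨δ₀, hδ₀, hsub⟩ := mem_nhdsGT_iff_exists_Ioo_subset.1 h1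
  have hδ₀ : 0 < δ₀ := hδ₀
  refine ⟨1 + (∫⁻ ζ, g ζ ∂circleMeasure) / ENNReal.ofReal δ₀, ?_, fun δ hδ => ?_⟩
  · exact ENNReal.add_ne_top.2 ⟨ENNReal.one_ne_top, ENNReal.div_ne_top hg (by simpa using hδ₀)⟩
  rcases lt_or_ge δ δ₀ with hlt | hge
  · exact (hsub ⟨hδ, hlt⟩ : _ ≤ _).trans le_self_add
  · exact (ENNReal.div_le_div (setLIntegral_le_lintegral _ _)
      (ENNReal.ofReal_le_ofReal hge)).trans le_add_self

lemma tendsto_lintegral_poissonKernel_mul {g : ℂ → ℝ≥0∞} {η : ℂ} (hη : ‖η‖ = 1)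
    (hgm : AEMeasurable g circleMeasure) (hg : ∫⁻ ζ, g ζ ∂circleMeasure ≠ ∞)
    (h : Tendsto (fun δ : ℝ => (∫⁻ ζ in Metric.closedBall η δ, g ζ ∂circleMeasure)
      / ENNReal.ofReal δ) (𝓝[>] 0) (𝓝 0)) :
    Tendsto (fun r : ℝ => ∫⁻ ζ, ENNReal.ofReal (poissonKernel 0 (r * η) ζ) * g ζ ∂circleMeasure)
      (𝓝[<] 1) (𝓝 0) := by
  obtain ⟨M, hM, hle⟩ := exists_lintegral_closedBall_div_le hg h
  set R : ℝ → ℝ≥0∞ := fun δ => (∫⁻ ζ in Metric.closedBall η δ, g ζ ∂circleMeasure)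
      / ENNReal.ofReal δ with hR
  -- Height `32 / (4^j (1 - r))` times radius `2^j (1 - r)` leaves the summable weight `32 / 2^j`.
  have hbound : ∀ r : ℝ, r ∈ Ioo (0 : ℝ) 1 →
      ∫⁻ ζ, ENNReal.ofReal (poissonKernel 0 (r * η) ζ) * g ζ ∂circleMeasure ≤
        ∑' j : ℕ, ENNReal.ofReal (32 / 2 ^ j) * R (2 ^ j * (1 - r)) := by
    rintro r ⟨h0, h1⟩
    have hy : 0 < 1 - r := by linarith
    calc _ ≤ ∫⁻ ζ, ∑' j : ℕ, (Metric.closedBall η (2 ^ j * (1 - r))).indicator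
          (fun ζ => ENNReal.ofReal (32 / (4 ^ j * (1 - r))) * g ζ) ζ ∂circleMeasure := by
          refine lintegral_mono_ae ?_
          filter_upwards [ae_norm_eq_one] with ζ hζ
          refine (mul_le_mul_left (poissonKernel_le_tsum h0 h1 hη hζ) _).trans ?_
          rw [← ENNReal.tsum_mul_right]
          refine ENNReal.tsum_le_tsum fun j => ?_
          by_cases hm : ζ ∈ Metric.closedBall η (2 ^ j * (1 - r)) <;> simp [hm]
      _ = ∑' j : ℕ, ENNReal.ofReal (32 / 2 ^ j) * R (2 ^ j * (1 - r)) := by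
          rw [lintegral_tsum fun j => (hgm.const_mul _).indicator
            Metric.isClosed_closedBall.measurableSet]
          congr 1 with j
          rw [lintegral_indicator Metric.isClosed_closedBall.measurableSet,
            lintegral_const_mul'' _ hgm.restrict, hR]
          have e : ENNReal.ofReal (32 / (4 ^ j * (1 - r))) =
              ENNReal.ofReal (32 / 2 ^ j) * (ENNReal.ofReal (2 ^ j * (1 - r)))⁻¹ := by
            rw [← ENNReal.ofReal_inv_of_pos (by positivity), ← ENNReal.ofReal_mul (by positivity)]
            congr 1
            have h4 : (4 : ℝ) ^ j = 2 ^ j * 2 ^ j := by rw [← mul_pow]; norm_num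
            rw [h4]; field_simp
          dsimp only
          rw [e, mul_assoc, ENNReal.div_eq_inv_mul]
  have hsum : Tendsto (fun r : ℝ => ∑' j : ℕ, ENNReal.ofReal (32 / 2 ^ j) * R (2 ^ j * (1 - r)))
      (𝓝[<] 1) (𝓝 0) := by
    -- Dominated convergence for the series, read as an integral against counting measure.
    have key := tendsto_lintegral_filter_of_dominated_convergence (μ := Measure.count)
      (l := 𝓝[<] (1 : ℝ)) (F := fun r (j : ℕ) => ENNReal.ofReal (32 / 2 ^ j) * R (2 ^ j * (1 - r)))
      (f := fun _ => 0) (fun j => ENNReal.ofReal (32 / 2 ^ j) * M)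
      (Eventually.of_forall fun r => measurable_of_countable _) ?_ ?_ ?_
    · simpa [lintegral_count] using key
    · filter_upwards [self_mem_nhdsWithin] with r (hr : r < 1)
      exact Eventually.of_forall fun j =>
        mul_le_mul_right (hle _ (mul_pos (by positivity) (by linarith))) _
    · rw [lintegral_count, ENNReal.tsum_mul_right]
      refine ENNReal.mul_ne_top ?_ hM
      have : Summable fun j : ℕ => (32 : ℝ) / 2 ^ j := by
        simpa [div_eq_mul_inv] using summable_geometric_two.mul_left (32 : ℝ)
      rw [← ENNReal.ofReal_tsum_of_nonneg (fun j => by positivity) this]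
      exact ENNReal.ofReal_ne_top
    · refine Eventually.of_forall fun j => ?_
      have h3 : Tendsto (fun r : ℝ => 2 ^ j * (1 - r)) (𝓝[<] 1) (𝓝[>] 0) := by
        refine tendsto_nhdsWithin_iff.2 ⟨?_, ?_⟩
        · have : Continuous fun r : ℝ => 2 ^ j * (1 - r) := by fun_prop
          simpa using this.continuousWithinAt (s := Iio 1) (x := 1) |>.tendsto
        · filter_upwards [self_mem_nhdsWithin] with r (hr : r < 1)
          exact mul_pos (pow_pos two_pos j) (sub_pos.2 hr)
      simpa using ENNReal.Tendsto.const_mul (h.comp h3) (a := ENNReal.ofReal (32 / 2 ^ j))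
        (Or.inr ENNReal.ofReal_ne_top)
  refine tendsto_of_tendsto_of_tendsto_of_le_of_le' tendsto_const_nhds hsum
    (Eventually.of_forall fun _ => zero_le) ?_
  filter_upwards [Ioo_mem_nhdsLT zero_lt_one] with r hr using hbound r hr

lemma integrable_poissonKernel_mul {φ : ℂ → ℂ} (hφ : Integrable φ circleMeasure) {z : ℂ}
    (hz : ‖z‖ < 1) : Integrable (fun ζ => (poissonKernel 0 z ζ : ℂ) * φ ζ) circleMeasure := by
  have hc : ContinuousOn (fun ζ => (poissonKernel 0 z ζ : ℂ)) (Metric.sphere 0 1) :=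
    Complex.continuous_ofReal.comp_continuousOn (continuousOn_poissonKernel hz)
  obtain ⟨C, hC⟩ := (isCompact_sphere (0 : ℂ) 1).exists_bound_of_continuousOn hc
  refine hφ.bdd_mul (c := C) (integrable_of_continuousOn_sphere hc).aestronglyMeasurable ?_
  filter_upwards [ae_norm_eq_one] with ζ hζ using hC ζ (by simpa using hζ)

/-- **Fatou's theorem**: the Poisson integral of an integrable function has it as radial limit. -/
theorem ae_tendsto_integral_poissonKernel_mul {φ : ℂ → ℂ} (hφ : Integrable φ circleMeasure) :
    ∀ᵐ η ∂circleMeasure, Tendsto (fun r : ℝ =>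
      ∫ ζ, (poissonKernel 0 (r * η) ζ : ℂ) * φ ζ ∂circleMeasure) (𝓝[<] 1) (𝓝 (φ η)) := by
  filter_upwards [tendsto_lintegral_closedBall_div hφ, ae_norm_eq_one] with η h hη
  have hint : Integrable (fun ζ => φ ζ - φ η) circleMeasure := hφ.sub (integrable_const _)
  have key := tendsto_lintegral_poissonKernel_mul hη hint.aestronglyMeasurable.enorm
    hint.hasFiniteIntegral.ne h
  rw [tendsto_iff_edist_tendsto_0]
  refine tendsto_of_tendsto_of_tendsto_of_le_of_le' tendsto_const_nhds key
    (Eventually.of_forall fun _ => zero_le) ?_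
  filter_upwards [Ioo_mem_nhdsLT zero_lt_one] with r hr
  have hz := norm_real_mul_lt_one hr.1 hr.2 hη
  -- The kernel has integral one, so the error is a Poisson average of `φ - φ η`.
  have e : ∫ ζ, (poissonKernel 0 (r * η) ζ : ℂ) * φ ζ ∂circleMeasure - φ η =
      ∫ ζ, (poissonKernel 0 (r * η) ζ : ℂ) * (φ ζ - φ η) ∂circleMeasure := by
    simp_rw [mul_sub]
    rw [integral_sub (integrable_poissonKernel_mul hφ hz)
      (integrable_poissonKernel_mul (integrable_const _) hz),
      integral_poissonKernel_mul (F := fun _ => φ η) diffContOnCl_const hz]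
  rw [edist_eq_enorm_sub, e]
  refine (enorm_integral_le_lintegral_enorm _).trans (lintegral_mono_ae ?_)
  filter_upwards [ae_norm_eq_one] with ζ hζ
  rw [enorm_mul, ← ofReal_norm, Complex.norm_real,
    Real.norm_of_nonneg (poissonKernel_nonneg hζ hz)]

/-! ### Fourier coefficients and limits of bounded sequences in `H²`. -/

lemma memLp_of_continuousOn_sphere {g : ℂ → ℂ} (hg : ContinuousOn g (Metric.sphere 0 1))
    (p : ℝ≥0∞) : MemLp g p circleMeasure := by
  obtain ⟨C, hC⟩ := (isCompact_sphere (0 : ℂ) 1).exists_bound_of_continuousOn hg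
  refine MemLp.of_bound (integrable_of_continuousOn_sphere hg).aestronglyMeasurable C ?_
  filter_upwards [ae_norm_eq_one] with ζ hζ using hC ζ (by simpa using hζ)

lemma memLp_pow (n : ℕ) (p : ℝ≥0∞) : MemLp (fun ζ : ℂ => ζ ^ n) p circleMeasure :=
  memLp_of_continuousOn_sphere (by fun_prop) p

lemma integral_pow (k : ℕ) : ∫ ζ, ζ ^ k ∂circleMeasure = if k = 0 then 1 else 0 := by
  have h := integral_div_one_sub_conj_mul (F := fun ζ => ζ ^ k)
    (Differentiable.diffContOnCl (by fun_prop)) (z := 0) (by simp)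
  simpa [zero_pow_eq] using h

lemma integral_conj_pow_mul_pow (n k : ℕ) :
    ∫ ζ, conj (ζ ^ n) * ζ ^ k ∂circleMeasure = if n = k then 1 else 0 := by
  have hcm : ∀ ζ : ℂ, ‖ζ‖ = 1 → ∀ j : ℕ, conj (ζ ^ j) * ζ ^ j = 1 := fun ζ hζ j => by
    rw [mul_comm, Complex.mul_conj, Complex.normSq_eq_norm_sq, norm_pow, hζ]; simp
  have key : ∀ n d : ℕ, ∫ ζ, conj (ζ ^ n) * ζ ^ (n + d) ∂circleMeasure
      = if d = 0 then 1 else 0 := fun n d => by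
    rw [← integral_pow]
    refine integral_congr_ae ?_
    filter_upwards [ae_norm_eq_one] with ζ hζ
    rw [pow_add, ← mul_assoc, hcm ζ hζ, one_mul]
  rcases le_total n k with h | h
  · obtain ⟨d, rfl⟩ := Nat.exists_eq_add_of_le h
    rw [key]; simp
  · obtain ⟨d, rfl⟩ := Nat.exists_eq_add_of_le h
    have e : ∫ ζ, conj (ζ ^ (k + d)) * ζ ^ k ∂circleMeasure
        = conj (∫ ζ, conj (ζ ^ k) * ζ ^ (k + d) ∂circleMeasure) := by
      rw [← integral_conj]
      simp [mul_comm]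
    rw [e, key]
    rcases d with _ | d <;> simp

lemma inner_toLp {f g : ℂ → ℂ} (hf : MemLp f 2 circleMeasure) (hg : MemLp g 2 circleMeasure) :
    inner ℂ (hf.toLp f) (hg.toLp g) = ∫ ζ, conj (f ζ) * g ζ ∂circleMeasure := by
  rw [L2.inner_def]
  refine integral_congr_ae ?_
  filter_upwards [hf.coeFn_toLp, hg.coeFn_toLp] with ζ h1 h2
  rw [h1, h2, RCLike.inner_apply, mul_comm]

lemma norm_toLp_sq {f : ℂ → ℂ} (hf : MemLp f 2 circleMeasure) :
    ‖hf.toLp f‖ ^ 2 = ∫ ζ, ‖f ζ‖ ^ 2 ∂circleMeasure := by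
  have h := inner_toLp hf hf
  rw [inner_self_eq_norm_sq_to_K] at h
  have e : ∫ ζ, conj (f ζ) * f ζ ∂circleMeasure = ((∫ ζ, ‖f ζ‖ ^ 2 ∂circleMeasure : ℝ) : ℂ) := by
    rw [← integral_complex_ofReal]
    congr 1 with ζ
    rw [mul_comm, Complex.mul_conj, Complex.normSq_eq_norm_sq]
  rw [e] at h
  exact Complex.ofReal_injective (by simpa using h)

/-- The monomial `ζ ^ n` in `L²` of the circle. -/
noncomputable def monomialLp (n : ℕ) : Lp ℂ 2 circleMeasure := (memLp_pow n 2).toLp _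

lemma orthonormal_monomialLp : Orthonormal ℂ monomialLp := by
  rw [orthonormal_iff_ite]
  intro i j
  rw [monomialLp, monomialLp, inner_toLp, integral_conj_pow_mul_pow]

/-- The `n`-th Fourier coefficient. -/
noncomputable def coeff (a : ℂ → ℂ) (n : ℕ) : ℂ := ∫ ζ, conj (ζ ^ n) * a ζ ∂circleMeasure

lemma sum_norm_coeff_sq_le {a : ℂ → ℂ} (ha : MemLp a 2 circleMeasure) (s : Finset ℕ) :
    ∑ n ∈ s, ‖coeff a n‖ ^ 2 ≤ ∫ ζ, ‖a ζ‖ ^ 2 ∂circleMeasure := by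
  have h := orthonormal_monomialLp.sum_inner_products_le (ha.toLp a) (s := s)
  rw [norm_toLp_sq] at h
  simpa only [monomialLp, inner_toLp, coeff] using h

lemma hasSum_coeff {a : ℂ → ℂ} (ha : Integrable a circleMeasure) {z : ℂ} (hz : ‖z‖ < 1) :
    HasSum (fun n => coeff a n * z ^ n) (∫ ζ, a ζ / (1 - conj ζ * z) ∂circleMeasure) := by
  have h : ∀ n, coeff a n * z ^ n = ∫ ζ, conj (ζ ^ n) * a ζ * z ^ n ∂circleMeasure := fun n => by
    rw [integral_mul_const, coeff]
  simp_rw [h]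
  have hgeom := summable_geometric_of_lt_one (norm_nonneg z) hz
  refine hasSum_integral_of_dominated_convergence (fun n ζ => ‖z‖ ^ n * ‖a ζ‖) (fun n => ?_)
    (fun n => ?_) ?_ ?_ ?_
  · refine AEStronglyMeasurable.mul_const (AEStronglyMeasurable.mul ?_ ha.aestronglyMeasurable) _
    exact (by fun_prop : Continuous fun ζ : ℂ => conj (ζ ^ n)).aestronglyMeasurable
  · filter_upwards [ae_norm_eq_one] with ζ hζ
    simp [hζ, mul_comm]
  · exact Eventually.of_forall fun ζ => hgeom.mul_right _
  · simp_rw [tsum_mul_right]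
    exact ha.norm.const_mul _
  · filter_upwards [ae_norm_eq_one] with ζ hζ
    have h1 : ‖conj ζ * z‖ < 1 := by simpa [hζ] using hz
    have h2 := (hasSum_geometric_of_norm_lt_one h1).mul_left (a ζ)
    rw [← div_eq_mul_inv] at h2
    refine h2.congr_fun fun n => ?_
    rw [map_pow, mul_pow]; ring

/-- Riesz–Fischer for the orthonormal monomials, restated for functions instead of classes. -/
lemma tendsto_eLpNorm_sum_pow_sub {α : ℕ → ℂ} (hα : Summable fun n => ‖α n‖ ^ 2) :
    ∃ A : ℂ → ℂ, MemLp A 2 circleMeasure ∧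
      Tendsto (fun K => eLpNorm ((fun ζ : ℂ => ∑ n ∈ Finset.range K, α n * ζ ^ n) - A) 2
        circleMeasure) atTop (𝓝 0) := by
  have hs : Summable fun n => α n • monomialLp n := by
    have := (orthonormal_monomialLp.orthogonalFamily.summable_iff_norm_sq_summable α).2 hα
    simpa using this
  refine ⟨_, Lp.memLp (∑' n, α n • monomialLp n), ?_⟩
  have h := (Lp.tendsto_Lp_iff_tendsto_eLpNorm' _ _).1 hs.hasSum.tendsto_sum_nat
  refine h.congr fun K => eLpNorm_congr_ae (EventuallyEq.sub ?_ EventuallyEq.rfl)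
  induction K with
  | zero =>
    filter_upwards [Lp.coeFn_zero (E := ℂ) (p := 2) (μ := circleMeasure)] with ζ
    simp
  | succ K ih =>
    rw [Finset.sum_range_succ]
    filter_upwards [ih, Lp.coeFn_add (∑ n ∈ Finset.range K, α n • monomialLp n)
      (α K • monomialLp K), Lp.coeFn_smul (α K) (monomialLp K),
      (memLp_pow K 2).coeFn_toLp (μ := circleMeasure)] with ζ h1 h2 h3 h4
    rw [h2, Pi.add_apply, h1, h3, Pi.smul_apply, monomialLp, h4, Finset.sum_range_succ, smul_eq_mul]

/-- A sequence of disc algebra functions bounded in `H²` has along every ultrafilter a pointwise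
limit, which is also the pointwise limit of polynomials that converge in `L²` of the circle. -/
lemma exists_tendsto_ultrafilter (U : Ultrafilter ℕ) {a : ℕ → ℂ → ℂ}
    (ha : ∀ N, DiffContOnCl ℂ (a N) (Metric.ball 0 1)) {M : ℝ}
    (hM : ∀ N, ∫ ζ, ‖a N ζ‖ ^ 2 ∂circleMeasure ≤ M) :
    ∃ (A : ℂ → ℂ) (p : ℕ → ℂ → ℂ), MemLp A 2 circleMeasure ∧ (∀ K, Differentiable ℂ (p K)) ∧
      Tendsto (fun K => eLpNorm (p K - A) 2 circleMeasure) atTop (𝓝 0) ∧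
      ∀ z : ℂ, ‖z‖ < 1 → ∃ v, Tendsto (fun N => a N z) U (𝓝 v) ∧
        Tendsto (fun K => p K z) atTop (𝓝 v) := by
  have hbes : ∀ N (s : Finset ℕ), ∑ n ∈ s, ‖coeff (a N) n‖ ^ 2 ≤ M := fun N s =>
    (sum_norm_coeff_sq_le (memLp_of_continuousOn_sphere (ha N).continuousOn_sphere 2) s).trans
      (hM N)
  have hc : ∀ N n, ‖coeff (a N) n‖ ≤ M + 1 := fun N n => by
    have := hbes N {n}
    rw [Finset.sum_singleton] at this
    nlinarith [sq_nonneg (‖coeff (a N) n‖ - 1)]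
  -- The ultrafilter makes all coefficients converge at once, with no diagonal subsequence.
  have hlim : ∀ n, ∃ α, Tendsto (fun N => coeff (a N) n) U (𝓝 α) := fun n => by
    obtain ⟨α, -, hα⟩ := (isCompact_closedBall (0 : ℂ) (M + 1)).ultrafilter_le_nhds
      (U.map fun N => coeff (a N) n) (by
        rw [le_principal_iff]
        exact Eventually.of_forall (f := (U : Filter ℕ)) fun N => by simpa using hc N n)
    exact ⟨α, hα⟩
  choose α hα using hlim
  -- Bessel's inequality is uniform in `N` and passes to the limit on finite sets.
  have hα2 : Summable fun n => ‖α n‖ ^ 2 :=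
    summable_of_sum_le (fun n => by positivity) fun s => le_of_tendsto
      (tendsto_finsetSum s fun n _ => ((hα n).norm.pow 2)) (Eventually.of_forall fun N => hbes N s)
  obtain ⟨A, hA, hpA⟩ := tendsto_eLpNorm_sum_pow_sub hα2
  refine ⟨A, fun K ζ => ∑ n ∈ Finset.range K, α n * ζ ^ n, hA, fun K => by fun_prop, hpA,
    fun z hz => ⟨∑' n, α n * z ^ n, ?_, ?_⟩⟩
  · have hgeom : Summable fun n => (M + 1) * ‖z‖ ^ n :=
      (summable_geometric_of_lt_one (norm_nonneg z) hz).mul_left _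
    have := tendsto_tsum_of_dominated_convergence (𝓕 := (U : Filter ℕ))
      (f := fun N n => coeff (a N) n * z ^ n) (g := fun n => α n * z ^ n) hgeom
      (fun n => (hα n).mul_const _) (Eventually.of_forall fun N n => by
        rw [norm_mul, norm_pow]; gcongr; exact hc N n)
    refine this.congr fun N => ?_
    rw [(hasSum_coeff (integrable_of_continuousOn_sphere (ha N).continuousOn_sphere) hz).tsum_eq,
      integral_div_one_sub_conj_mul (ha N) hz]
  · refine (Summable.hasSum ?_).tendsto_sum_nat
    refine Summable.of_norm_bounded ((summable_geometric_of_lt_one (norm_nonneg z) hz).mul_left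
      (M + 1)) fun n => ?_
    rw [norm_mul, norm_pow]
    gcongr
    exact le_of_tendsto (hα n).norm (Eventually.of_forall fun N => hc N n)

/-! ### Representation of `H¹` functions by integrable functions. -/

lemma exists_polynomial_near {h : ℂ → ℂ} (hh : DifferentiableOn ℂ h (Metric.ball 0 1)) {ρ : ℝ}
    (h0 : 0 < ρ) (h1 : ρ < 1) {ε : ℝ} (hε : 0 < ε) :
    ∃ q : Polynomial ℂ, ∀ w : ℂ, ‖w‖ ≤ 1 → ‖h (ρ * w) - q.eval w‖ < ε := by
  -- Taylor polynomials converge uniformly on a ball of radius `r'` with `ρ < r' < R < 1`. The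
  -- factor `ρ ^ n` in the coefficients below absorbs the dilation.
  obtain ⟨R, hρR, hR1⟩ := exists_between h1
  obtain ⟨r', hρr, hrR⟩ := exists_between hρR
  lift R to NNReal using (h0.trans hρR).le
  lift r' to NNReal using (h0.trans hρr).le
  have hp := (hh.mono (Metric.closedBall_subset_ball hR1)).hasFPowerSeriesOnBall
    (show 0 < R by exact_mod_cast h0.trans hρR)
  have hu := hp.tendstoUniformlyOn' (r' := r') (by exact_mod_cast hrR)
  obtain ⟨K, hK⟩ := (Metric.tendstoUniformlyOn_iff.1 hu ε hε).exists
  set P := cauchyPowerSeries h 0 R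
  refine ⟨∑ n ∈ Finset.range K, Polynomial.C (P.coeff n * ρ ^ n) * Polynomial.X ^ n,
    fun w hw => ?_⟩
  have hw' : (ρ : ℂ) * w ∈ Metric.ball (0 : ℂ) r' := by
    rw [mem_ball_zero_iff, norm_mul, Complex.norm_real, Real.norm_of_nonneg h0.le]
    nlinarith
  have := hK _ hw'
  rw [dist_eq_norm] at this
  convert! this using 3
  rw [FormalMultilinearSeries.partialSum, Polynomial.eval_finsetSum]
  refine Finset.sum_congr rfl fun n _ => ?_
  rw [sub_zero, FormalMultilinearSeries.apply_eq_pow_smul_coeff]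
  simp only [Polynomial.eval_mul, Polynomial.eval_C, Polynomial.eval_pow, Polynomial.eval_X,
    smul_eq_mul]
  ring

lemma mapsTo_real_mul_sphere {r : ℝ} (h0 : 0 < r) (h1 : r < 1) :
    MapsTo (fun ζ : ℂ => (r : ℂ) * ζ) (Metric.closedBall 0 1) (Metric.ball 0 1) := by
  intro ζ hζ
  have hζ : ‖ζ‖ ≤ 1 := by simpa using hζ
  rw [mem_ball_zero_iff, norm_mul, Complex.norm_real, Real.norm_of_nonneg h0.le]
  nlinarith

lemma diffContOnCl_dilation {h : ℂ → ℂ} (hh : DifferentiableOn ℂ h (Metric.ball 0 1)) {r : ℝ}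
    (h0 : 0 < r) (h1 : r < 1) :
    DiffContOnCl ℂ (fun ζ : ℂ => h (r * ζ)) (Metric.ball 0 1) := by
  refine DifferentiableOn.diffContOnCl ?_
  rw [closure_ball _ one_ne_zero]
  exact hh.comp (by fun_prop) (mapsTo_real_mul_sphere h0 h1)

lemma exists_seq_polynomial {h : ℂ → ℂ} (hh : DifferentiableOn ℂ h (Metric.ball 0 1)) {M : ℝ≥0∞}
    (hM : M ≠ ∞)
    (hle : ∀ r ∈ Ioo (0 : ℝ) 1, ∫⁻ ζ, ‖h ((r : ℂ) * ζ)‖ₑ ∂circleMeasure ≤ M) :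
    ∃ q : ℕ → Polynomial ℂ, (∀ N, ∫ ζ, ‖(q N).eval ζ‖ ∂circleMeasure ≤ M.toReal + 1) ∧
      ∀ z : ℂ, ‖z‖ < 1 → Tendsto (fun N => (q N).eval z) atTop (𝓝 (h z)) := by
  -- The shift by `2` keeps `ρ 0` positive. The approximation errors `1 / (N + 1) ≤ 1` account for
  -- the `+ 1` in the norm bound.
  set ρ : ℕ → ℝ := fun N => 1 - 1 / ((N : ℝ) + 2) with hρ
  have hρ01 : ∀ N, ρ N ∈ Ioo (0 : ℝ) 1 := fun N => by
    have : 1 / ((N : ℝ) + 2) < 1 := by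
      rw [div_lt_one (by positivity)]
      linarith [N.cast_nonneg (α := ℝ)]
    exact ⟨by simpa [hρ] using this, sub_lt_self _ (by positivity)⟩
  choose q hq using fun N : ℕ => exists_polynomial_near hh (hρ01 N).1 (hρ01 N).2
    (Nat.one_div_pos_of_nat (α := ℝ) (n := N))
  refine ⟨q, fun N => ?_, fun z hz => ?_⟩
  · have hint : Integrable (fun ζ => h ((ρ N : ℂ) * ζ)) circleMeasure :=
      integrable_of_continuousOn_sphere
        (diffContOnCl_dilation hh (hρ01 N).1 (hρ01 N).2).continuousOn_sphere
    have hqi : Integrable (fun ζ => (q N).eval ζ) circleMeasure :=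
      integrable_of_continuousOn_sphere (q N).continuous.continuousOn
    calc ∫ ζ, ‖(q N).eval ζ‖ ∂circleMeasure
        ≤ ∫ ζ, (‖h ((ρ N : ℂ) * ζ)‖ + 1) ∂circleMeasure := by
          refine integral_mono_ae hqi.norm (hint.norm.add (integrable_const 1)) ?_
          filter_upwards [ae_norm_eq_one] with ζ hζ
          have h1 := hq N ζ hζ.le
          have h2 : 1 / ((N : ℝ) + 1) ≤ 1 := by
            rw [div_le_one (by positivity)]; linarith [N.cast_nonneg (α := ℝ)]
          have h3 := norm_sub_norm_le ((q N).eval ζ) (h (ρ N * ζ))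
          rw [norm_sub_rev] at h3
          linarith
      _ = (∫⁻ ζ, ‖h ((ρ N : ℂ) * ζ)‖ₑ ∂circleMeasure).toReal + 1 := by
          rw [integral_add hint.norm (integrable_const 1),
            integral_norm_eq_lintegral_enorm hint.aestronglyMeasurable]
          simp
      _ ≤ M.toReal + 1 := by gcongr; exact hle _ (hρ01 N)
  · have hρ1 : Tendsto ρ atTop (𝓝 1) := by
      have h1 := (tendsto_one_div_add_atTop_nhds_zero_nat (𝕜 := ℝ)).comp (tendsto_add_atTop_nat 1)
      have h2 := h1.const_sub 1
      rw [sub_zero] at h2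
      refine h2.congr fun N => ?_
      simp only [Function.comp_apply, hρ]
      push_cast
      ring
    have hz' : z ∈ Metric.ball (0 : ℂ) 1 := by simpa using hz
    have hc : Tendsto (fun N => h ((ρ N : ℂ) * z)) atTop (𝓝 (h z)) := by
      refine ((hh.continuousOn.continuousAt (Metric.isOpen_ball.mem_nhds hz')).tendsto).comp ?_
      have := ((Complex.continuous_ofReal.tendsto 1).comp hρ1).mul_const z
      simpa using this
    have hd : Tendsto (fun N => h ((ρ N : ℂ) * z) - (q N).eval z) atTop (𝓝 0) :=
      squeeze_zero_norm (fun N => (hq N z hz.le).le) (tendsto_one_div_add_atTop_nhds_zero_nat)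
    simpa using hc.sub hd

lemma tendsto_integral_mul_mul {A B k : ℂ → ℂ} {p q : ℕ → ℂ → ℂ} (hA : MemLp A 2 circleMeasure)
    (hB : MemLp B 2 circleMeasure) (hp : ∀ K, MemLp (p K) 2 circleMeasure)
    (hq : ∀ K, MemLp (q K) 2 circleMeasure)
    (hpA : Tendsto (fun K => eLpNorm (p K - A) 2 circleMeasure) atTop (𝓝 0))
    (hqB : Tendsto (fun K => eLpNorm (q K - B) 2 circleMeasure) atTop (𝓝 0))
    (hk : ContinuousOn k (Metric.sphere 0 1)) :
    Tendsto (fun K => ∫ ζ, k ζ * (p K ζ * q K ζ) ∂circleMeasure) atTop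
      (𝓝 (∫ ζ, k ζ * (A ζ * B ζ) ∂circleMeasure)) := by
  obtain ⟨C, hC⟩ := (isCompact_sphere (0 : ℂ) 1).exists_bound_of_continuousOn hk
  have hkm : AEStronglyMeasurable k circleMeasure :=
    (integrable_of_continuousOn_sphere hk).aestronglyMeasurable
  have hkC : ∀ᵐ ζ ∂circleMeasure, ‖k ζ‖ ≤ C := by
    filter_upwards [ae_norm_eq_one] with ζ hζ using hC ζ (by simpa using hζ)
  refine tendsto_integral_of_L1' _ (hkm.mul (hA.1.mul hB.1))
    (Eventually.of_forall fun K => ((hp K).integrable_mul (hq K)).bdd_mul hkm hkC) ?_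
  have hpbd : Tendsto (fun K => eLpNorm (p K - A) 2 circleMeasure + eLpNorm A 2 circleMeasure)
      atTop (𝓝 (eLpNorm A 2 circleMeasure)) := by simpa using hpA.add_const _
  have hmain : Tendsto (fun K => ENNReal.ofReal C *
      ((eLpNorm (p K - A) 2 circleMeasure + eLpNorm A 2 circleMeasure) *
        eLpNorm (q K - B) 2 circleMeasure +
        eLpNorm (p K - A) 2 circleMeasure * eLpNorm B 2 circleMeasure)) atTop (𝓝 0) := by
    have h1 := ENNReal.Tendsto.mul hpbd (Or.inr ENNReal.zero_ne_top) hqB (Or.inr hA.2.ne)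
    have h2 := ENNReal.Tendsto.mul_const hpA (b := eLpNorm B 2 circleMeasure) (Or.inr hB.2.ne)
    simpa using ENNReal.Tendsto.const_mul (h1.add h2) (a := ENNReal.ofReal C)
      (Or.inr ENNReal.ofReal_ne_top)
  refine tendsto_of_tendsto_of_tendsto_of_le_of_le tendsto_const_nhds hmain (fun _ => zero_le)
    fun K => ?_
  -- The splitting `pq - AB = p (q - B) + (p - A) B` reduces the `L¹` convergence to Hölder's
  -- inequality.
  have e : (fun ζ => k ζ * (p K ζ * q K ζ)) - (fun ζ => k ζ * (A ζ * B ζ)) =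
      k • (p K • (q K - B) + (p K - A) • B) := by
    funext ζ
    simp only [Pi.sub_apply, Pi.smul_apply', Pi.add_apply, smul_eq_mul, Pi.mul_apply]
    ring
  have hqBm := ((hq K).sub hB).1
  have hpAm := ((hp K).sub hA).1
  calc _ = eLpNorm (k • (p K • (q K - B) + (p K - A) • B)) 1 circleMeasure := by rw [← e]; rfl
    _ ≤ ENNReal.ofReal C * eLpNorm (p K • (q K - B) + (p K - A) • B) 1 circleMeasure := by
        refine eLpNorm_le_mul_eLpNorm_of_ae_le_mul ?_ 1
        filter_upwards [hkC] with ζ hζ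
        rw [Pi.smul_apply', norm_smul]
        gcongr
    _ ≤ _ := by
        gcongr
        refine (eLpNorm_add_le ((hp K).1.smul hqBm) (hpAm.smul hB.1) le_rfl).trans ?_
        refine add_le_add ((eLpNorm_smul_le_mul_eLpNorm (p := 2) (q := 2) (r := 1)
          hqBm (hp K).1).trans ?_)
          (eLpNorm_smul_le_mul_eLpNorm (p := 2) (q := 2) (r := 1) hB.1 hpAm)
        gcongr
        have := eLpNorm_add_le hpAm hA.1 (one_le_two : (1 : ℝ≥0∞) ≤ 2)
        rwa [sub_add_cancel] at this

/-- **The Riesz representation of `H¹`**: a function of `H¹` is the Poisson integral and the Cauchy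
integral of an integrable function on the circle. -/
theorem exists_integrable_forall_integral_eq {h : ℂ → ℂ}
    (hh : DifferentiableOn ℂ h (Metric.ball 0 1)) {M : ℝ≥0∞} (hM : M ≠ ∞)
    (hle : ∀ r ∈ Ioo (0 : ℝ) 1, ∫⁻ ζ, ‖h ((r : ℂ) * ζ)‖ₑ ∂circleMeasure ≤ M) :
    ∃ φ : ℂ → ℂ, Integrable φ circleMeasure ∧ ∀ z : ℂ, ‖z‖ < 1 →
      ∫ ζ, (poissonKernel 0 z ζ : ℂ) * φ ζ ∂circleMeasure = h z ∧
      ∫ ζ, φ ζ / (1 - conj ζ * z) ∂circleMeasure = h z := by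
  obtain ⟨q, hq, hqh⟩ := exists_seq_polynomial hh hM hle
  choose a b ha hb hab hn using fun N => hasSqrtFactorization_eval (q N)
  have hna : ∀ N, ∫ ζ, ‖a N ζ‖ ^ 2 ∂circleMeasure ≤ M.toReal + 1 := fun N =>
    (integral_congr_ae (by filter_upwards [ae_norm_eq_one] with ζ hζ using (hn N ζ hζ).1)).trans_le
      (hq N)
  have hnb : ∀ N, ∫ ζ, ‖b N ζ‖ ^ 2 ∂circleMeasure ≤ M.toReal + 1 := fun N =>
    (integral_congr_ae (by filter_upwards [ae_norm_eq_one] with ζ hζ using (hn N ζ hζ).2)).trans_le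
      (hq N)
  obtain ⟨A, p, hA, hp, hpA, hpz⟩ := exists_tendsto_ultrafilter (hyperfilter ℕ) ha hna
  obtain ⟨B, s, hB, hs, hsB, hsz⟩ := exists_tendsto_ultrafilter (hyperfilter ℕ) hb hnb
  have hU : (hyperfilter ℕ : Filter ℕ) ≤ atTop := by
    rw [← Nat.cofinite_eq_atTop]; exact hyperfilter_le_cofinite
  -- Both factors are taken along the same ultrafilter, so their pointwise limits multiply to `h z`.
  -- The same limits are reached by the polynomials `p K` and `s K`, which moreover converge in
  -- `L²`.
  have hps : ∀ z : ℂ, ‖z‖ < 1 → Tendsto (fun K => p K z * s K z) atTop (𝓝 (h z)) := by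
    intro z hz
    obtain ⟨v, hv1, hv2⟩ := hpz z hz
    obtain ⟨w, hw1, hw2⟩ := hsz z hz
    have h1 : Tendsto (fun N => (q N).eval z) (hyperfilter ℕ) (𝓝 (v * w)) :=
      (hv1.mul hw1).congr fun N => (hab N z hz.le).symm
    rw [tendsto_nhds_unique ((hqh z hz).mono_left hU) h1]
    exact hv2.mul hw2
  have hpsd : ∀ K, DiffContOnCl ℂ (fun ζ => p K ζ * s K ζ) (Metric.ball 0 1) := fun K =>
    ((hp K).mul (hs K)).diffContOnCl
  have key : ∀ k : ℂ → ℂ, ContinuousOn k (Metric.sphere 0 1) →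
      Tendsto (fun K => ∫ ζ, k ζ * (p K ζ * s K ζ) ∂circleMeasure) atTop
        (𝓝 (∫ ζ, k ζ * (A ζ * B ζ) ∂circleMeasure)) := fun k hk =>
    tendsto_integral_mul_mul hA hB
      (fun K => memLp_of_continuousOn_sphere (hp K).continuous.continuousOn 2)
      (fun K => memLp_of_continuousOn_sphere (hs K).continuous.continuousOn 2) hpA hsB hk
  refine ⟨fun ζ => A ζ * B ζ, hA.integrable_mul hB, fun z hz => ⟨?_, ?_⟩⟩
  · refine tendsto_nhds_unique (key _
      (Complex.continuous_ofReal.comp_continuousOn (continuousOn_poissonKernel hz))) ?_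
    exact (hps z hz).congr fun K => (integral_poissonKernel_mul (hpsd K) hz).symm
  · simp_rw [div_eq_inv_mul]
    refine tendsto_nhds_unique (key _ (continuousOn_cauchyKernel hz)) ?_
    refine (hps z hz).congr fun K => ?_
    rw [← integral_div_one_sub_conj_mul (hpsd K) hz]
    simp_rw [div_eq_inv_mul]

/-! ### Hardy norms and boundary values. -/

lemma hardyNorm_one (f : ℂ → ℂ) : hardyNorm 1 f =
    ⨆ r ∈ Ioo (0 : ℝ) 1, ∫⁻ ζ, ‖f ((r : ℂ) * ζ)‖ₑ ∂circleMeasure := by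
  simp [hardyNorm]

lemma hardyNorm_top (f : ℂ → ℂ) : hardyNorm ∞ f = ⨆ z ∈ Metric.ball (0 : ℂ) 1, ‖f z‖ₑ := by
  simp [hardyNorm]

lemma lintegral_le_hardyNorm_one (f : ℂ → ℂ) {r : ℝ} (hr : r ∈ Ioo (0 : ℝ) 1) :
    ∫⁻ ζ, ‖f ((r : ℂ) * ζ)‖ₑ ∂circleMeasure ≤ hardyNorm 1 f := by
  rw [hardyNorm_one]
  exact le_iSup₂ (f := fun (r : ℝ) (_ : r ∈ Ioo (0 : ℝ) 1) =>
    ∫⁻ ζ, ‖f ((r : ℂ) * ζ)‖ₑ ∂circleMeasure) r hr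

lemma enorm_le_hardyNorm_top (f : ℂ → ℂ) {z : ℂ} (hz : ‖z‖ < 1) : ‖f z‖ₑ ≤ hardyNorm ∞ f := by
  rw [hardyNorm_top]
  exact le_iSup₂ (f := fun (z : ℂ) (_ : z ∈ Metric.ball (0 : ℂ) 1) => ‖f z‖ₑ) z (by simpa using hz)

lemma hardyNorm_one_le_hardyNorm_top (f : ℂ → ℂ) : hardyNorm 1 f ≤ hardyNorm ∞ f := by
  rw [hardyNorm_one]
  refine iSup₂_le fun r hr => ?_
  calc _ ≤ ∫⁻ _, hardyNorm ∞ f ∂circleMeasure := by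
        refine lintegral_mono_ae ?_
        filter_upwards [ae_norm_eq_one] with ζ hζ using
          enorm_le_hardyNorm_top f (norm_real_mul_lt_one hr.1 hr.2 hζ)
    _ = hardyNorm ∞ f := by simp

lemma MemHardy.memHardy_one {h : ℂ → ℂ} {p : ℝ≥0∞} (hh : MemHardy p h) (hp : p = 1 ∨ p = ∞) :
    MemHardy 1 h := by
  rcases hp with rfl | rfl
  · exact hh
  · exact ⟨hh.1, (hardyNorm_one_le_hardyNorm_top h).trans_lt hh.2⟩

lemma boundaryValue_eq_of_tendsto {h : ℂ → ℂ} {ζ v : ℂ}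
    (hv : Tendsto (fun r : ℝ => h ((r : ℂ) * ζ)) (𝓝[<] 1) (𝓝 v)) : boundaryValue h ζ = v :=
  hv.limUnder_eq

/-- A function of `H¹` has radial limits almost everywhere, and it is the Cauchy integral of its
integrable boundary function. -/
theorem MemHardy.boundaryValue_spec {h : ℂ → ℂ} (hh : MemHardy 1 h) :
    (∀ᵐ η ∂circleMeasure, Tendsto (fun r : ℝ => h ((r : ℂ) * η)) (𝓝[<] 1)
      (𝓝 (boundaryValue h η))) ∧
    Integrable (boundaryValue h) circleMeasure ∧
    ∀ z : ℂ, ‖z‖ < 1 → ∫ ζ, boundaryValue h ζ / (1 - conj ζ * z) ∂circleMeasure = h z := by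
  obtain ⟨φ, hφ, hφh⟩ := exists_integrable_forall_integral_eq hh.1 hh.2.ne
    fun r hr => lintegral_le_hardyNorm_one h hr
  have hlim : ∀ᵐ η ∂circleMeasure, Tendsto (fun r : ℝ => h ((r : ℂ) * η)) (𝓝[<] 1) (𝓝 (φ η)) := by
    filter_upwards [ae_tendsto_integral_poissonKernel_mul hφ, ae_norm_eq_one] with η h1 h2
    refine h1.congr' ?_
    filter_upwards [Ioo_mem_nhdsLT zero_lt_one] with r hr
    exact (hφh _ (norm_real_mul_lt_one hr.1 hr.2 h2)).1
  have heq : boundaryValue h =ᵐ[circleMeasure] φ := by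
    filter_upwards [hlim] with η h1 using boundaryValue_eq_of_tendsto h1
  refine ⟨?_, hφ.congr heq.symm, fun z hz => ?_⟩
  · filter_upwards [hlim, heq] with η h1 h2
    rwa [h2]
  · rw [← (hφh z hz).2]
    refine integral_congr_ae ?_
    filter_upwards [heq] with ζ h1
    rw [h1]

lemma MemHardy.ae_enorm_boundaryValue_le {h : ℂ → ℂ} (hh : MemHardy ∞ h) :
    ∀ᵐ η ∂circleMeasure, ‖boundaryValue h η‖ₑ ≤ hardyNorm ∞ h := by
  filter_upwards [(hh.memHardy_one (Or.inr rfl)).boundaryValue_spec.1, ae_norm_eq_one] with η h1 h2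
  refine le_of_tendsto h1.enorm ?_
  filter_upwards [Ioo_mem_nhdsLT zero_lt_one] with r hr
  exact enorm_le_hardyNorm_top h (norm_real_mul_lt_one hr.1 hr.2 h2)

lemma MemHardy.lintegral_enorm_boundaryValue_le {h : ℂ → ℂ} (hh : MemHardy 1 h) :
    ∫⁻ ζ, ‖boundaryValue h ζ‖ₑ ∂circleMeasure ≤ hardyNorm 1 h := by
  obtain ⟨r, hr⟩ := exists_seq_tendsto (𝓝[<] (1 : ℝ))
  have hr01 : ∀ᶠ n in atTop, r n ∈ Ioo (0 : ℝ) 1 := hr (Ioo_mem_nhdsLT zero_lt_one)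
  obtain ⟨N, hN⟩ := eventually_atTop.1 hr01
  -- Fatou's lemma needs a sequence of radii; the shift by `N` puts all of them in `(0, 1)`.
  have hr' := hr.comp (tendsto_add_atTop_nat N)
  have hrN : ∀ n, r (n + N) ∈ Ioo (0 : ℝ) 1 := fun n => hN _ (by omega)
  calc ∫⁻ ζ, ‖boundaryValue h ζ‖ₑ ∂circleMeasure
      = ∫⁻ ζ, liminf (fun n => ‖h ((r (n + N) : ℂ) * ζ)‖ₑ) atTop ∂circleMeasure := by
        refine lintegral_congr_ae ?_
        filter_upwards [hh.boundaryValue_spec.1] with ζ hζ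
        exact (hζ.enorm.comp hr').liminf_eq.symm
    _ ≤ liminf (fun n => ∫⁻ ζ, ‖h ((r (n + N) : ℂ) * ζ)‖ₑ ∂circleMeasure) atTop :=
        lintegral_liminf_le' fun n => (integrable_of_continuousOn_sphere (diffContOnCl_dilation hh.1
          (hrN n).1 (hrN n).2).continuousOn_sphere).aestronglyMeasurable.enorm
    _ ≤ hardyNorm 1 h := by
        refine liminf_le_of_le (by isBoundedDefault) fun b hb => ?_
        obtain ⟨n, hn⟩ := hb.exists
        exact hn.trans (lintegral_le_hardyNorm_one h (hrN n))

/-! ### Analyticity of Cauchy integrals, maximum principle and integral means. -/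

lemma integrable_div_one_sub_conj_mul {ψ : ℂ → ℂ} (hψ : Integrable ψ circleMeasure) {z : ℂ}
    (hz : ‖z‖ < 1) : Integrable (fun ζ => ψ ζ / (1 - conj ζ * z)) circleMeasure := by
  have hc := continuousOn_cauchyKernel hz
  obtain ⟨C, hC⟩ := (isCompact_sphere (0 : ℂ) 1).exists_bound_of_continuousOn hc
  simp_rw [div_eq_inv_mul]
  refine hψ.bdd_mul (c := C) (integrable_of_continuousOn_sphere hc).aestronglyMeasurable ?_
  filter_upwards [ae_norm_eq_one] with ζ hζ using hC ζ (by simpa using hζ)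

/-- The integral is a power series whose coefficients are bounded by the `L¹` norm of `ψ`. -/
lemma differentiableOn_integral_div_one_sub_conj_mul {ψ : ℂ → ℂ}
    (hψ : Integrable ψ circleMeasure) :
    DifferentiableOn ℂ (fun z => ∫ ζ, ψ ζ / (1 - conj ζ * z) ∂circleMeasure)
      (Metric.ball 0 1) := by
  intro z hz
  obtain ⟨R, hzR, hR1⟩ := exists_between (show ‖z‖ < 1 by simpa using hz)
  have hR0 : 0 ≤ R := (norm_nonneg z).trans hzR.le
  have hcoeff : ∀ n, ‖coeff ψ n‖ ≤ ∫ ζ, ‖ψ ζ‖ ∂circleMeasure := fun n => by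
    refine (norm_integral_le_integral_norm _).trans_eq (integral_congr_ae ?_)
    filter_upwards [ae_norm_eq_one] with ζ hζ
    simp [hζ]
  have hd : DifferentiableOn ℂ (fun w => ∑' n, coeff ψ n * w ^ n) (Metric.ball 0 R) := by
    refine Complex.differentiableOn_tsum_of_summable_norm
      ((summable_geometric_of_lt_one hR0 hR1).mul_left (∫ ζ, ‖ψ ζ‖ ∂circleMeasure))
      (fun n => by fun_prop) Metric.isOpen_ball fun n w hw => ?_
    rw [norm_mul, norm_pow]
    have hw : ‖w‖ < R := by simpa using hw
    gcongr
    exact hcoeff n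
  have hzR' : Metric.ball (0 : ℂ) R ∈ 𝓝 z := Metric.isOpen_ball.mem_nhds (by simpa using hzR)
  refine ((hd.differentiableAt hzR').congr_of_eventuallyEq ?_).differentiableWithinAt
  filter_upwards [hzR'] with w hw
  exact (hasSum_coeff hψ ((by simpa using hw : ‖w‖ < R).trans hR1)).tsum_eq.symm

lemma enorm_le_lintegral_poissonKernel {G : ℂ → ℂ} (hG : DiffContOnCl ℂ G (Metric.ball 0 1))
    {z : ℂ} (hz : ‖z‖ < 1) :
    ‖G z‖ₑ ≤ ∫⁻ ζ, ENNReal.ofReal (poissonKernel 0 z ζ) * ‖G ζ‖ₑ ∂circleMeasure := by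
  rw [← integral_poissonKernel_mul hG hz]
  refine (enorm_integral_le_lintegral_enorm _).trans (lintegral_mono_ae ?_)
  filter_upwards [ae_norm_eq_one] with ζ hζ
  rw [enorm_mul, ← ofReal_norm, Complex.norm_real,
    Real.norm_of_nonneg (poissonKernel_nonneg hζ hz)]

/-- The maximum principle with an almost everywhere bound on the circle. -/
lemma enorm_le_of_ae_le {G : ℂ → ℂ} (hG : DiffContOnCl ℂ G (Metric.ball 0 1)) {C : ℝ≥0∞}
    (hC : ∀ᵐ ζ ∂circleMeasure, ‖G ζ‖ₑ ≤ C) {z : ℂ} (hz : ‖z‖ < 1) : ‖G z‖ₑ ≤ C := by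
  refine (enorm_le_lintegral_poissonKernel hG hz).trans ?_
  calc _ ≤ ∫⁻ ζ, ENNReal.ofReal (poissonKernel 0 z ζ) * C ∂circleMeasure := by
        refine lintegral_mono_ae ?_
        filter_upwards [hC] with ζ hζ
        gcongr
    _ = C := by
        rw [lintegral_mul_const'' _ (integrable_of_continuousOn_sphere
          (continuousOn_poissonKernel hz)).aestronglyMeasurable.aemeasurable.ennreal_ofReal,
          lintegral_poissonKernel hz, one_mul]

lemma poissonKernel_real_mul_comm {s : ℝ} {η ζ : ℂ} (hη : ‖η‖ = 1) (hζ : ‖ζ‖ = 1) :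
    poissonKernel 0 (s * η) ζ = poissonKernel 0 (s * ζ) η := by
  rw [poissonKernel_of_norm_eq_one hζ, poissonKernel_of_norm_eq_one hη]
  have : ‖ζ - s * η‖ ^ 2 = ‖η - s * ζ‖ ^ 2 := by
    have h1 : ‖η‖ ^ 2 = 1 := by rw [hη, one_pow]
    have h2 : ‖ζ‖ ^ 2 = 1 := by rw [hζ, one_pow]
    rw [Complex.sq_norm, Complex.normSq_apply] at *
    rw [Complex.sq_norm, Complex.normSq_apply] at *
    simp only [Complex.sub_re, Complex.sub_im, Complex.re_ofReal_mul, Complex.im_ofReal_mul]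
    linear_combination (s ^ 2 - 1) * h1 + (1 - s ^ 2) * h2
  rw [this, norm_mul, norm_mul, hη, hζ]

/-- `|G|` is dominated by the Poisson integral of its boundary values. Tonelli and the symmetry of
the kernel in `η` and `ζ` then give total weight one to each `ζ`. -/
lemma lintegral_enorm_dilation_le {G : ℂ → ℂ} (hG : DiffContOnCl ℂ G (Metric.ball 0 1)) {s : ℝ}
    (h0 : 0 < s) (h1 : s < 1) :
    ∫⁻ η, ‖G ((s : ℂ) * η)‖ₑ ∂circleMeasure ≤ ∫⁻ ζ, ‖G ζ‖ₑ ∂circleMeasure := by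
  have hGm : AEMeasurable (fun ζ => ‖G ζ‖ₑ) circleMeasure :=
    (integrable_of_continuousOn_sphere hG.continuousOn_sphere).aestronglyMeasurable.enorm
  have hPm : Measurable (Function.uncurry fun η ζ : ℂ =>
      ENNReal.ofReal (poissonKernel 0 ((s : ℂ) * η) ζ)) := by
    simp only [poissonKernel_def, sub_zero]
    fun_prop
  calc ∫⁻ η, ‖G ((s : ℂ) * η)‖ₑ ∂circleMeasure
      ≤ ∫⁻ η, ∫⁻ ζ, ENNReal.ofReal (poissonKernel 0 (s * η) ζ) * ‖G ζ‖ₑ ∂circleMeasure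
          ∂circleMeasure := by
        refine lintegral_mono_ae ?_
        filter_upwards [ae_norm_eq_one] with η hη using
          enorm_le_lintegral_poissonKernel hG (norm_real_mul_lt_one h0 h1 hη)
    _ = ∫⁻ ζ, ∫⁻ η, ENNReal.ofReal (poissonKernel 0 (s * η) ζ) * ‖G ζ‖ₑ ∂circleMeasure
          ∂circleMeasure := lintegral_lintegral_swap (hPm.aemeasurable.mul hGm.comp_snd)
    _ = ∫⁻ ζ, ‖G ζ‖ₑ ∂circleMeasure := by
        refine lintegral_congr_ae ?_
        filter_upwards [ae_norm_eq_one] with ζ hζ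
        rw [lintegral_mul_const' _ _ enorm_ne_top]
        have : ∫⁻ η, ENNReal.ofReal (poissonKernel 0 (s * η) ζ) ∂circleMeasure = 1 := by
          rw [← lintegral_poissonKernel (norm_real_mul_lt_one h0 h1 hζ)]
          refine lintegral_congr_ae ?_
          filter_upwards [ae_norm_eq_one] with η hη
          rw [poissonKernel_real_mul_comm hη hζ]
        rw [this, one_mul]

/-- For unimodular `ζ`, `η` one has `|ζ - rη|² - r |ζ - η|² = (1 - r)²`. -/
lemma sqrt_mul_norm_sub_le {r : ℝ} (h0 : 0 ≤ r) {η ζ : ℂ} (hη : ‖η‖ = 1) (hζ : ‖ζ‖ = 1) :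
    √r * ‖ζ - η‖ ≤ ‖ζ - r * η‖ := by
  refine (sq_le_sq₀ (by positivity) (norm_nonneg _)).1 ?_
  rw [mul_pow, Real.sq_sqrt h0]
  have h1 : ‖η‖ ^ 2 = 1 := by rw [hη, one_pow]
  have h2 : ‖ζ‖ ^ 2 = 1 := by rw [hζ, one_pow]
  simp only [Complex.sq_norm, Complex.normSq_apply, Complex.sub_re, Complex.sub_im,
    Complex.re_ofReal_mul, Complex.im_ofReal_mul] at *
  nlinarith [sq_nonneg (1 - r)]

/-! ### The Toeplitz operator and its norm bounds. -/

lemma MemHardy.integrable_conj_boundaryValue_mul {f ψ : ℂ → ℂ} (hf : MemHardy ∞ f)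
    (hψ : Integrable ψ circleMeasure) :
    Integrable (fun ζ => conj (boundaryValue f ζ) * ψ ζ) circleMeasure := by
  have hfm := (hf.memHardy_one (Or.inr rfl)).boundaryValue_spec.2.1.aestronglyMeasurable
  refine hψ.bdd_mul (c := (hardyNorm ∞ f).toReal)
    (Complex.continuous_conj.comp_aestronglyMeasurable hfm) ?_
  filter_upwards [hf.ae_enorm_boundaryValue_le] with ζ hζ
  rw [Complex.norm_conj, ← toReal_enorm]
  exact ENNReal.toReal_mono hf.2.ne hζ

lemma integrable_toeplitzIntegrand {f h : ℂ → ℂ} (hf : MemHardy ∞ f) (hh : MemHardy 1 h) {z : ℂ}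
    (hz : ‖z‖ < 1) : Integrable (toeplitzIntegrand f h z) circleMeasure :=
  integrable_div_one_sub_conj_mul
    (hf.integrable_conj_boundaryValue_mul hh.boundaryValue_spec.2.1) hz

lemma differentiableOn_toeplitz {f h : ℂ → ℂ} (hf : MemHardy ∞ f) (hh : MemHardy 1 h) :
    DifferentiableOn ℂ (toeplitz f h) (Metric.ball 0 1) :=
  differentiableOn_integral_div_one_sub_conj_mul
    (hf.integrable_conj_boundaryValue_mul hh.boundaryValue_spec.2.1)

lemma toeplitz_linear {f h₁ h₂ : ℂ → ℂ} (hf : MemHardy ∞ f) (hh₁ : MemHardy 1 h₁)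
    (hh₂ : MemHardy 1 h₂) (a b : ℂ) {z : ℂ} (hz : ‖z‖ < 1) :
    toeplitz f (fun w => a * h₁ w + b * h₂ w) z = a * toeplitz f h₁ z + b * toeplitz f h₂ z := by
  rw [toeplitz, toeplitz, toeplitz, ← integral_const_mul, ← integral_const_mul,
    ← integral_add ((integrable_toeplitzIntegrand hf hh₁ hz).const_mul a)
      ((integrable_toeplitzIntegrand hf hh₂ hz).const_mul b)]
  refine integral_congr_ae ?_
  -- `limUnder` is additive only where both radial limits exist, which is almost everywhere.
  filter_upwards [hh₁.boundaryValue_spec.1, hh₂.boundaryValue_spec.1] with ζ h1 h2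
  have h3 : boundaryValue (fun w => a * h₁ w + b * h₂ w) ζ =
      a * boundaryValue h₁ ζ + b * boundaryValue h₂ ζ :=
    boundaryValue_eq_of_tendsto ((h1.const_mul a).add (h2.const_mul b))
  simp only [toeplitzIntegrand, h3]
  ring

/-- The Cauchy formula for `h` evaluates the contribution of the constant. Choosing `c` as the
boundary value of `f` at `η` makes the remaining integrand small near `η`. -/
lemma toeplitz_eq_add_integral {f h : ℂ → ℂ} (hf : MemHardy ∞ f) (hh : MemHardy 1 h) (c : ℂ)
    {z : ℂ} (hz : ‖z‖ < 1) : toeplitz f h z = conj c * h z +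
      ∫ ζ, conj (boundaryValue f ζ - c) * boundaryValue h ζ / (1 - conj ζ * z) ∂circleMeasure := by
  obtain ⟨-, hint, hcauchy⟩ := hh.boundaryValue_spec
  rw [← hcauchy z hz, ← integral_const_mul, toeplitz]
  have h1 := (integrable_div_one_sub_conj_mul hint hz).const_mul (conj c)
  rw [← sub_eq_iff_eq_add', ← integral_sub (integrable_toeplitzIntegrand hf hh hz) h1]
  congr 1 with ζ
  simp only [toeplitzIntegrand, map_sub]
  ring

/-- The kernel `|f(ζ) - f(η)| / |ζ - η|` whose integrals define `lambda`. -/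
noncomputable def diffQuotient (f : ℂ → ℂ) (η ζ : ℂ) : ℝ≥0∞ :=
  ‖boundaryValue f ζ - boundaryValue f η‖ₑ / ‖ζ - η‖ₑ

lemma diffQuotient_comm (f : ℂ → ℂ) (η ζ : ℂ) : diffQuotient f η ζ = diffQuotient f ζ η := by
  rw [diffQuotient, diffQuotient, enorm_sub_rev, enorm_sub_rev ζ]

lemma ae_lintegral_diffQuotient_le (f : ℂ → ℂ) :
    ∀ᵐ η ∂circleMeasure, ∫⁻ ζ, diffQuotient f η ζ ∂circleMeasure ≤ lambda f :=
  ENNReal.ae_le_essSup _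

lemma enorm_toeplitz_le {f h : ℂ → ℂ} (hf : MemHardy ∞ f) (hh : MemHardy 1 h) {r : ℝ}
    (h0 : 0 < r) (h1 : r < 1) {η : ℂ} (hη : ‖η‖ = 1) :
    ‖toeplitz f h (r * η)‖ₑ ≤ ‖boundaryValue f η‖ₑ * ‖h (r * η)‖ₑ + (ENNReal.ofReal √r)⁻¹ *
      ∫⁻ ζ, diffQuotient f η ζ * ‖boundaryValue h ζ‖ₑ ∂circleMeasure := by
  have hz := norm_real_mul_lt_one h0 h1 hη
  have hs : 0 < √r := Real.sqrt_pos.2 h0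
  have hs0 : ENNReal.ofReal √r ≠ 0 := by simpa using hs
  rw [toeplitz_eq_add_integral hf hh (boundaryValue f η) hz]
  refine (enorm_add_le _ _).trans (add_le_add ?_ ?_)
  · rw [enorm_mul, ← ofReal_norm, Complex.norm_conj, ofReal_norm]
  rw [← lintegral_const_mul' _ _ (ENNReal.inv_ne_top.2 hs0)]
  refine (enorm_integral_le_lintegral_enorm _).trans (lintegral_mono_ae ?_)
  filter_upwards [ae_norm_eq_one] with ζ hζ
  have hD := one_sub_conj_mul_ne_zero hζ hz
  have hle : ENNReal.ofReal √r * ‖ζ - η‖ₑ ≤ ‖1 - conj ζ * (r * η)‖ₑ := by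
    rw [← ofReal_norm, ← ofReal_norm, ← ENNReal.ofReal_mul hs.le, norm_one_sub_conj_mul hζ]
    exact ENNReal.ofReal_le_ofReal (sqrt_mul_norm_sub_le h0.le hη hζ)
  -- This also holds at `ζ = η`: both numerators vanish there and `0 / 0 = 0` in `ℝ≥0∞`.
  have hK : ‖boundaryValue f ζ - boundaryValue f η‖ₑ / ‖1 - conj ζ * (r * η)‖ₑ ≤
      (ENNReal.ofReal √r)⁻¹ * diffQuotient f η ζ := by
    refine (ENNReal.div_le_div_left hle _).trans_eq ?_
    rw [diffQuotient, div_eq_mul_inv, div_eq_mul_inv,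
      ENNReal.mul_inv (Or.inl hs0) (Or.inl ENNReal.ofReal_ne_top), mul_left_comm]
  calc _ = ‖boundaryValue f ζ - boundaryValue f η‖ₑ / ‖1 - conj ζ * (r * η)‖ₑ *
        ‖boundaryValue h ζ‖ₑ := by
        rw [div_eq_mul_inv, enorm_mul, enorm_mul, enorm_inv hD, ← ofReal_norm (conj _),
          Complex.norm_conj, ofReal_norm, mul_right_comm, div_eq_mul_inv]
    _ ≤ (ENNReal.ofReal √r)⁻¹ * diffQuotient f η ζ * ‖boundaryValue h ζ‖ₑ :=
        mul_le_mul' hK le_rfl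
    _ = _ := mul_assoc _ _ _

lemma tendsto_toeplitz_bound {a b c : ℝ≥0∞} (hb : b ≠ ∞) (hc : c ≠ ∞) :
    Tendsto (fun r : ℝ => a * c + (ENNReal.ofReal √r)⁻¹ * (b * c)) (𝓝[<] 1)
      (𝓝 ((a + b) * c)) := by
  have h1 : Tendsto (fun r : ℝ => (ENNReal.ofReal √r)⁻¹) (𝓝[<] 1) (𝓝 1) := by
    have : Continuous fun r : ℝ => (ENNReal.ofReal √r)⁻¹ :=
      (ENNReal.continuous_ofReal.comp Real.continuous_sqrt).inv
    simpa using (this.tendsto 1).mono_left nhdsWithin_le_nhds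
  have h2 := (ENNReal.Tendsto.mul_const h1 (b := b * c)
    (Or.inr (ENNReal.mul_ne_top hb hc))).const_add (a * c)
  rwa [one_mul, ← add_mul] at h2

lemma hardyNorm_top_toeplitz_le {f h : ℂ → ℂ} (hf : MemHardy ∞ f) (hΛ : lambda f < ∞)
    (hh : MemHardy ∞ h) :
    hardyNorm ∞ (toeplitz f h) ≤ (hardyNorm ∞ f + lambda f) * hardyNorm ∞ h := by
  have hh1 := hh.memHardy_one (Or.inr rfl)
  have hd := differentiableOn_toeplitz hf hh1
  have hcircle : ∀ r ∈ Ioo (0 : ℝ) 1, ∀ᵐ η ∂circleMeasure, ‖toeplitz f h (r * η)‖ₑ ≤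
      hardyNorm ∞ f * hardyNorm ∞ h + (ENNReal.ofReal √r)⁻¹ * (lambda f * hardyNorm ∞ h) := by
    rintro r ⟨h0, h1⟩
    filter_upwards [ae_norm_eq_one, hf.ae_enorm_boundaryValue_le,
      ae_lintegral_diffQuotient_le f] with η hη hfη hΛη
    refine (enorm_toeplitz_le hf hh1 h0 h1 hη).trans ?_
    gcongr
    · exact enorm_le_hardyNorm_top h (norm_real_mul_lt_one h0 h1 hη)
    · calc ∫⁻ ζ, diffQuotient f η ζ * ‖boundaryValue h ζ‖ₑ ∂circleMeasure
          ≤ ∫⁻ ζ, diffQuotient f η ζ * hardyNorm ∞ h ∂circleMeasure := by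
            refine lintegral_mono_ae ?_
            filter_upwards [hh.ae_enorm_boundaryValue_le] with ζ hζ
            gcongr
        _ ≤ lambda f * hardyNorm ∞ h := by
            rw [lintegral_mul_const' _ _ hh.2.ne]
            gcongr
  rw [hardyNorm_top (toeplitz f h)]
  refine iSup₂_le fun z hz => ?_
  have hz1 : ‖z‖ < 1 := by simpa using hz
  have hlim : Tendsto (fun r : ℝ => ‖toeplitz f h (r * z)‖ₑ) (𝓝[<] 1) (𝓝 ‖toeplitz f h z‖ₑ) := by
    refine (Tendsto.comp (y := 𝓝 z) (hd.continuousOn.continuousAt (Metric.isOpen_ball.mem_nhds hz))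
      ?_).enorm
    have : Continuous fun r : ℝ => (r : ℂ) * z := by fun_prop
    simpa using (this.tendsto 1).mono_left nhdsWithin_le_nhds
  -- For fixed `z`, the maximum principle on the dilation by `r` carries the circle bound to `rz`;
  -- then `r → 1`.
  refine le_of_tendsto_of_tendsto hlim
    (tendsto_toeplitz_bound hΛ.ne hh.2.ne) ?_
  filter_upwards [Ioo_mem_nhdsLT zero_lt_one] with r hr
  exact enorm_le_of_ae_le (diffContOnCl_dilation hd hr.1 hr.2) (hcircle r hr) hz1

/-- After exchanging the integrals, symmetry of the quotient lets `lambda f` bound the inner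
integral for almost every `ζ`. -/
lemma lintegral_lintegral_diffQuotient_mul_le {f h : ℂ → ℂ} (hf : MemHardy ∞ f)
    (hh : MemHardy 1 h) :
    ∫⁻ η, ∫⁻ ζ, diffQuotient f η ζ * ‖boundaryValue h ζ‖ₑ ∂circleMeasure ∂circleMeasure ≤
      lambda f * hardyNorm 1 h := by
  have hfm := (hf.memHardy_one (Or.inr rfl)).boundaryValue_spec.2.1.aestronglyMeasurable
  have hhm := hh.boundaryValue_spec.2.1.aestronglyMeasurable
  have hm : AEMeasurable (Function.uncurry fun η ζ => diffQuotient f η ζ * ‖boundaryValue h ζ‖ₑ)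
      (circleMeasure.prod circleMeasure) := by
    refine AEMeasurable.mul (AEMeasurable.div ?_ ?_) hhm.comp_snd.enorm
    · exact (hfm.comp_snd.sub hfm.comp_fst).enorm
    · exact (by fun_prop : Measurable fun p : ℂ × ℂ => ‖p.2 - p.1‖ₑ).aemeasurable
  rw [lintegral_lintegral_swap hm]
  calc _ ≤ ∫⁻ ζ, lambda f * ‖boundaryValue h ζ‖ₑ ∂circleMeasure := by
        refine lintegral_mono_ae ?_
        filter_upwards [ae_lintegral_diffQuotient_le f] with ζ hζ
        simp_rw [diffQuotient_comm f _ ζ]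
        rw [lintegral_mul_const' _ _ enorm_ne_top]
        gcongr
    _ ≤ lambda f * hardyNorm 1 h := by
        rw [lintegral_const_mul'' _ hhm.enorm]
        gcongr
        exact hh.lintegral_enorm_boundaryValue_le

lemma hardyNorm_one_toeplitz_le {f h : ℂ → ℂ} (hf : MemHardy ∞ f) (hΛ : lambda f < ∞)
    (hh : MemHardy 1 h) :
    hardyNorm 1 (toeplitz f h) ≤ (hardyNorm ∞ f + lambda f) * hardyNorm 1 h := by
  have hd := differentiableOn_toeplitz hf hh
  have hcircle : ∀ r ∈ Ioo (0 : ℝ) 1, ∫⁻ η, ‖toeplitz f h (r * η)‖ₑ ∂circleMeasure ≤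
      hardyNorm ∞ f * hardyNorm 1 h + (ENNReal.ofReal √r)⁻¹ * (lambda f * hardyNorm 1 h) := by
    rintro r ⟨h0, h1⟩
    have hs0 : ENNReal.ofReal √r ≠ 0 := by simpa using h0
    have hhm : AEMeasurable (fun η => ‖h ((r : ℂ) * η)‖ₑ) circleMeasure :=
      (integrable_of_continuousOn_sphere
        (diffContOnCl_dilation hh.1 h0 h1).continuousOn_sphere).aestronglyMeasurable.enorm
    calc ∫⁻ η, ‖toeplitz f h (r * η)‖ₑ ∂circleMeasure
        ≤ ∫⁻ η, (hardyNorm ∞ f * ‖h (r * η)‖ₑ + (ENNReal.ofReal √r)⁻¹ *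
            ∫⁻ ζ, diffQuotient f η ζ * ‖boundaryValue h ζ‖ₑ ∂circleMeasure) ∂circleMeasure := by
          refine lintegral_mono_ae ?_
          filter_upwards [ae_norm_eq_one, hf.ae_enorm_boundaryValue_le] with η hη hfη
          refine (enorm_toeplitz_le hf hh h0 h1 hη).trans ?_
          gcongr
      _ ≤ _ := by
          rw [lintegral_add_left' (hhm.const_mul _), lintegral_const_mul'' _ hhm,
            lintegral_const_mul' _ _ (ENNReal.inv_ne_top.2 hs0)]
          gcongr
          · exact lintegral_le_hardyNorm_one h ⟨h0, h1⟩
          · exact lintegral_lintegral_diffQuotient_mul_le hf hh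
  rw [hardyNorm_one (toeplitz f h)]
  refine iSup₂_le fun t ht => ?_
  refine ge_of_tendsto
    (tendsto_toeplitz_bound hΛ.ne hh.2.ne) ?_
  -- The mean over radius `t` is at most that over any `r` in `(t, 1)`, through dilation by `t / r`.
  -- Hence `t` stays fixed while the bound for `r` tends to its limit.
  filter_upwards [Ioo_mem_nhdsLT ht.2] with r hr
  have hr0 : 0 < r := ht.1.trans hr.1
  refine le_trans ?_ (hcircle r ⟨hr0, hr.2⟩)
  have := lintegral_enorm_dilation_le (diffContOnCl_dilation hd hr0 hr.2) (s := t / r)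
    (div_pos ht.1 hr0) ((div_lt_one hr0).2 hr.1)
  refine le_of_eq_of_le ?_ this
  have hrc : (r : ℂ) ≠ 0 := by exact_mod_cast hr0.ne'
  congr 1 with η
  push_cast
  rw [← mul_assoc, mul_div_cancel₀ _ hrc]

end HardyToeplitz

theorem theorem1 (f : ℂ → ℂ) (hf : HardyToeplitz.MemHardy ∞ f)
    (hΛ : HardyToeplitz.lambda f < ∞) (p : ℝ≥0∞) (hp : p = 1 ∨ p = ∞) :
    -- the integral defining `T_f h` converges absolutely for every `h ∈ H^p`,
    (∀ h : ℂ → ℂ, HardyToeplitz.MemHardy p h → ∀ z ∈ Metric.ball (0 : ℂ) 1,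
      Integrable (HardyToeplitz.toeplitzIntegrand f h z) HardyToeplitz.circleMeasure) ∧
    -- `T_f` is linear on `H^p`,
    (∀ h₁ h₂ : ℂ → ℂ, HardyToeplitz.MemHardy p h₁ → HardyToeplitz.MemHardy p h₂ →
      ∀ a b : ℂ, ∀ z ∈ Metric.ball (0 : ℂ) 1,
        HardyToeplitz.toeplitz f (fun w => a * h₁ w + b * h₂ w) z =
          a * HardyToeplitz.toeplitz f h₁ z + b * HardyToeplitz.toeplitz f h₂ z) ∧
    -- and `T_f` maps `H^p` into `H^p` with norm at most `‖f‖_∞ + Λ(f)`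
    (∀ h : ℂ → ℂ, HardyToeplitz.MemHardy p h →
      HardyToeplitz.MemHardy p (HardyToeplitz.toeplitz f h) ∧
      HardyToeplitz.hardyNorm p (HardyToeplitz.toeplitz f h) ≤
        (HardyToeplitz.hardyNorm ∞ f + HardyToeplitz.lambda f) *
          HardyToeplitz.hardyNorm p h) := by
  refine ⟨fun h hh z hz => ?_, fun h₁ h₂ hh₁ hh₂ a b z hz => ?_, fun h hh => ?_⟩
  · exact HardyToeplitz.integrable_toeplitzIntegrand hf (hh.memHardy_one hp) (by simpa using hz)
  · exact HardyToeplitz.toeplitz_linear hf (hh₁.memHardy_one hp) (hh₂.memHardy_one hp) a b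
      (by simpa using hz)
  · have hle : HardyToeplitz.hardyNorm p (HardyToeplitz.toeplitz f h) ≤
        (HardyToeplitz.hardyNorm ∞ f + HardyToeplitz.lambda f) * HardyToeplitz.hardyNorm p h := by
      rcases hp with rfl | rfl
      · exact HardyToeplitz.hardyNorm_one_toeplitz_le hf hΛ hh
      · exact HardyToeplitz.hardyNorm_top_toeplitz_le hf hΛ hh
    refine ⟨⟨HardyToeplitz.differentiableOn_toeplitz hf (hh.memHardy_one hp), ?_⟩, hle⟩
    exact hle.trans_lt (ENNReal.mul_lt_top (ENNReal.add_lt_top.2 ⟨hf.2, hΛ⟩) hh.2)
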